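/- Let $n\ge 0$ be an integer, let $A=(a_{ij})$ be a real symmetric positive definite $n\times n$ matrix, and let $w_1,\dots,w_n>0$ be such that $w_1^2,\dots,w_n^2$ are the eigenvalues of $A$, listed with multiplicity. Let $K=-\Delta+\langle Ax,x\rangle$ be the harmonic oscillator, viewed as an unbounded operator on the complex Hilbert space $L^2(\mathbb{R}^n)$ with domain $\{u\in H^2(\mathbb{R}^n): \langle Ax,x\rangle u\in L^2(\mathbb{R}^n)\}$, where $\Delta$ is the distributional Laplacian and $\langle Ax,x\rangle=\sum_{i,j}a_{ij}x_ix_j$. The spectrum $\sigma(K)$ is the set of all $\lambda\in\mathbb{C}$ for which $K-\lambda$ has no bounded, everywhere defined two-sided inverse. Then $$\sigma(K)=\Big\{\sum_{i=1}^n(2n_i+1)w_i \;:\; n_1,\dots,n_n\in\mathbb{Z}_{\ge 0}\Big\},$$ and the set of eigenvalues of $K$ (those $\lambda\in\mathbb{C}$ with $Ku=\lambda u$ for some nonzero $u$ in the domain of $K$) is equal to the same set. -/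

import Mathlib

open MeasureTheory
open scoped SchwartzMap Laplacian

/-- The complex Hilbert space `L²(ℝⁿ)`. -/
abbrev L2Space (n : ℕ) : Type :=
  Lp ℂ 2 (volume : Measure (EuclideanSpace ℝ (Fin n)))

namespace HarmonicOscillator

variable {n : ℕ}

/-- The embedding of `L²(ℝⁿ)` into tempered distributions is injective. -/
theorem toDistribution_injective {f g : L2Space n}
    (h : (f : 𝓢'(EuclideanSpace ℝ (Fin n), ℂ)) = (g : 𝓢'(EuclideanSpace ℝ (Fin n), ℂ))) :
    f = g := by
  have hk := Lp.ker_toTemperedDistributionCLM_eq_bot (F := ℂ) (p := 2)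
    (μ := (volume : Measure (EuclideanSpace ℝ (Fin n))))
  exact (LinearMap.ker_eq_bot.mp hk) h

/-- The distributional Laplacian of an `H²` function is (represented by) an `L²` function. -/
theorem exists_laplacian_eq {u : L2Space n}
    (hu : TemperedDistribution.MemSobolev 2 2 (u : 𝓢'(EuclideanSpace ℝ (Fin n), ℂ))) :
    ∃ f : L2Space n, Δ (u : 𝓢'(EuclideanSpace ℝ (Fin n), ℂ)) =
      (f : 𝓢'(EuclideanSpace ℝ (Fin n), ℂ)) := by
  have h := hu.laplacian
  rw [sub_self] at h
  exact TemperedDistribution.memSobolev_zero_iff.mp h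

/-- The Sobolev space `H²(ℝⁿ)` as a subspace of `L²(ℝⁿ)`. -/
noncomputable def sobolevH2 (n : ℕ) : Submodule ℂ (L2Space n) where
  carrier := {u | TemperedDistribution.MemSobolev 2 2 (u : 𝓢'(EuclideanSpace ℝ (Fin n), ℂ))}
  zero_mem' := by
    have h := TemperedDistribution.memSobolev_fun_zero (EuclideanSpace ℝ (Fin n)) ℂ 2 2
    rwa [← map_zero (Lp.toTemperedDistributionCLM ℂ
      (volume : Measure (EuclideanSpace ℝ (Fin n))) 2)] at h
  add_mem' {u v} hu hv := by
    have h := hu.add hv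
    simp only [← Lp.toTemperedDistributionCLM_apply, ← map_add] at h
    exact h
  smul_mem' c u hu := by
    have h := TemperedDistribution.MemSobolev.smul c hu
    simp only [← Lp.toTemperedDistributionCLM_apply, ← map_smul] at h
    exact h

theorem mem_sobolevH2_iff {u : L2Space n} : u ∈ sobolevH2 n ↔
    TemperedDistribution.MemSobolev 2 2 (u : 𝓢'(EuclideanSpace ℝ (Fin n), ℂ)) :=
  Iff.rfl

/-- The `L²` function that represents the distributional Laplacian of an `H²` function. -/
noncomputable def laplacianFun (u : sobolevH2 n) : L2Space n :=
  Classical.choose (exists_laplacian_eq (mem_sobolevH2_iff.mp u.2))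

theorem laplacianFun_spec (u : sobolevH2 n) :
    (laplacianFun u : 𝓢'(EuclideanSpace ℝ (Fin n), ℂ)) =
      Δ ((u : L2Space n) : 𝓢'(EuclideanSpace ℝ (Fin n), ℂ)) :=
  (Classical.choose_spec (exists_laplacian_eq (mem_sobolevH2_iff.mp u.2))).symm

/-- The Laplacian as an unbounded operator on `L²(ℝⁿ)` with domain `H²(ℝⁿ)`: it sends `u` to the
unique `L²` function that represents the distributional Laplacian of `u`. -/
noncomputable def laplacianOp (n : ℕ) : L2Space n →ₗ.[ℂ] L2Space n where
  domain := sobolevH2 n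
  toFun :=
    { toFun := laplacianFun
      map_add' := fun u v => by
        have hu := laplacianFun_spec u
        have hv := laplacianFun_spec v
        have huv := laplacianFun_spec (u + v)
        apply toDistribution_injective
        simp only [← Lp.toTemperedDistributionCLM_apply,
          ← TemperedDistribution.laplacianCLM_apply, Submodule.coe_add, map_add] at hu hv huv ⊢
        rw [huv, hu, hv]
      map_smul' := fun c u => by
        have hu := laplacianFun_spec u
        have hcu := laplacianFun_spec (c • u)
        apply toDistribution_injective
        simp only [← Lp.toTemperedDistributionCLM_apply,
          ← TemperedDistribution.laplacianCLM_apply, Submodule.coe_smul, map_smul,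
          RingHom.id_apply] at hu hcu ⊢
        rw [hcu, hu] }

/-- The subspace `D(V)` of all `u ∈ L²(ℝⁿ)` with `V u ∈ L²(ℝⁿ)`. -/
noncomputable def potentialDomain (V : EuclideanSpace ℝ (Fin n) → ℝ) :
    Submodule ℂ (L2Space n) where
  carrier := {u | MemLp (fun x => (V x : ℂ) * u x) 2 volume}
  zero_mem' := by
    have h : MemLp (fun _ : EuclideanSpace ℝ (Fin n) => (0 : ℂ)) 2 volume := MemLp.zero'
    refine h.ae_eq ?_
    filter_upwards [Lp.coeFn_zero ℂ 2 (volume : Measure (EuclideanSpace ℝ (Fin n)))] with x hx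
    simp only [hx, Pi.zero_apply, mul_zero]
  add_mem' {u v} hu hv := by
    refine (MemLp.add hu hv).ae_eq ?_
    filter_upwards [Lp.coeFn_add u v] with x hx
    simp only [Pi.add_apply, hx, mul_add]
  smul_mem' c u hu := by
    refine (MemLp.const_smul hu c).ae_eq ?_
    filter_upwards [Lp.coeFn_smul c u] with x hx
    simp only [Pi.smul_apply, smul_eq_mul, hx]
    ring

theorem mem_potentialDomain_iff {V : EuclideanSpace ℝ (Fin n) → ℝ} {u : L2Space n} :
    u ∈ potentialDomain V ↔ MemLp (fun x => (V x : ℂ) * u x) 2 volume :=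
  Iff.rfl

/-- The product `V u` as an element of `L²(ℝⁿ)`, for `u ∈ D(V)`. -/
noncomputable def potentialFun (V : EuclideanSpace ℝ (Fin n) → ℝ) (u : potentialDomain V) :
    L2Space n :=
  (mem_potentialDomain_iff.mp u.2).toLp (fun x => (V x : ℂ) * (u : L2Space n) x)

theorem potentialFun_ae_eq (V : EuclideanSpace ℝ (Fin n) → ℝ) (u : potentialDomain V) :
    ∀ᵐ x, potentialFun V u x = (V x : ℂ) * (u : L2Space n) x :=
  (mem_potentialDomain_iff.mp u.2).coeFn_toLp

/-- Multiplication by a real function `V`, as an unbounded operator on `L²(ℝⁿ)` with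
domain `D(V)`. -/
noncomputable def potentialOp (V : EuclideanSpace ℝ (Fin n) → ℝ) :
    L2Space n →ₗ.[ℂ] L2Space n where
  domain := potentialDomain V
  toFun :=
    { toFun := potentialFun V
      map_add' := fun u v => by
        apply Lp.ext
        filter_upwards [Lp.coeFn_add (potentialFun V u) (potentialFun V v),
          Lp.coeFn_add (u : L2Space n) (v : L2Space n), potentialFun_ae_eq V u,
          potentialFun_ae_eq V v, potentialFun_ae_eq V (u + v)] with x h1 h2 h3 h4 h5
        rw [h1, h5, Submodule.coe_add, h2, Pi.add_apply, Pi.add_apply, h3, h4, mul_add]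
      map_smul' := fun c u => by
        apply Lp.ext
        filter_upwards [Lp.coeFn_smul c (potentialFun V u),
          Lp.coeFn_smul c (u : L2Space n), potentialFun_ae_eq V u,
          potentialFun_ae_eq V (c • u)] with x h1 h2 h3 h4
        rw [RingHom.id_apply, h1, h4, Submodule.coe_smul, h2, Pi.smul_apply, Pi.smul_apply, h3,
          smul_eq_mul, smul_eq_mul]
        ring }

/-- The quadratic form `⟨Ax, x⟩ = ∑ᵢⱼ aᵢⱼ xᵢ xⱼ` on `ℝⁿ`. -/
noncomputable def quadraticPotential (A : Matrix (Fin n) (Fin n) ℝ)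
    (x : EuclideanSpace ℝ (Fin n)) : ℝ :=
  ∑ i, ∑ j, A i j * x i * x j

/-- The harmonic oscillator `K = -Δ + ⟨Ax, x⟩` on `L²(ℝⁿ)`. The sum of unbounded operators has
as its domain the intersection of the domains, here `H²(ℝⁿ) ∩ D(⟨Ax, x⟩)`. -/
noncomputable def harmonicOscillator (A : Matrix (Fin n) (Fin n) ℝ) :
    L2Space n →ₗ.[ℂ] L2Space n :=
  -laplacianOp n + potentialOp (quadraticPotential A)

theorem mem_harmonicOscillator_domain_iff {A : Matrix (Fin n) (Fin n) ℝ} {u : L2Space n} :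
    u ∈ (harmonicOscillator A).domain ↔
      u ∈ sobolevH2 n ∧ u ∈ potentialDomain (quadraticPotential A) :=
  Iff.rfl

theorem harmonicOscillator_apply (A : Matrix (Fin n) (Fin n) ℝ) (u : L2Space n)
    (h : u ∈ (harmonicOscillator A).domain)
    (h₁ : u ∈ sobolevH2 n) (h₂ : u ∈ potentialDomain (quadraticPotential A)) :
    harmonicOscillator A ⟨u, h⟩ =
      -laplacianFun ⟨u, h₁⟩ + potentialFun (quadraticPotential A) ⟨u, h₂⟩ :=
  rfl

end HarmonicOscillator

section UnboundedSpectrum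

variable {H : Type*} [NormedAddCommGroup H] [NormedSpace ℂ H]

/-- The resolvent set of an unbounded operator `T`: all `z` for which `T - z`, as a map from the
domain of `T` to the whole space, has an everywhere defined bounded two-sided inverse `R`. -/
def unboundedResolventSet (T : H →ₗ.[ℂ] H) : Set ℂ :=
  {z | ∃ R : H →L[ℂ] H,
    (∀ f : H, ∃ h : R f ∈ T.domain, T ⟨R f, h⟩ - z • R f = f) ∧
    (∀ u : T.domain, R (T u - z • (u : H)) = u)}

/-- The spectrum of an unbounded operator: the complement of the resolvent set. -/
def unboundedSpectrum (T : H →ₗ.[ℂ] H) : Set ℂ :=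
  (unboundedResolventSet T)ᶜ

/-- The set of eigenvalues of an unbounded operator. -/
def unboundedEigenvalues (T : H →ₗ.[ℂ] H) : Set ℂ :=
  {z | ∃ u : T.domain, (u : H) ≠ 0 ∧ T u = z • (u : H)}

end UnboundedSpectrum

/-! In coordinates that diagonalise `A`, the oscillator on Schwartz functions is `∑ᵢ (aᵢ†aᵢ + wᵢ)`,
with `aᵢ†` = `raising`, `aᵢ` = `lowering` and `[aᵢ, aⱼ†] = 2wᵢδᵢⱼ`. The Gaussian killed by every
`aᵢ` has energy `∑ wᵢ`, each `aᵢ†` adds `2wᵢ`, and no `aᵢ†` kills a nonzero function. So every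
listed number is an eigenvalue with a Schwartz eigenfunction.

Nothing else occurs because these eigenfunctions are complete. Their span is stable under
multiplication by linear forms, so it contains all powers of linear forms times the Gaussian; an
`L²` function orthogonal to these, multiplied by the Gaussian, has zero Fourier transform
(`eq_zero_of_inner_position_pow_groundState`). Symmetry of `K` against Schwartz functions then
excludes further eigenvalues. If `z` is not an energy, discreteness gives a distance `δ > 0` to all
energies, and by orthogonality `K - z` is invertible on the algebraic sum of the eigenspaces with
inverse bounded by `δ⁻¹`. A limit argument extends this to all of `L²`.

The limits must lie in `H² ∩ D(V)`, not merely in the domain of the closure. This is the role of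
`norm_schwartzPotential_sq_le`: `Vφ` is controlled by `Kφ` and `φ`, so `Δφ` and `Vφ` converge
separately. -/

namespace HarmonicOscillator

open scoped LineDeriv ComplexConjugate

/-! ### Position and derivative operators on Schwartz functions -/

section Operators

variable {n : ℕ}

/-- Multiplication of Schwartz functions by the linear form `⟨v, x⟩`. -/
noncomputable def position (v : EuclideanSpace ℝ (Fin n)) :
    𝓢(EuclideanSpace ℝ (Fin n), ℂ) →ₗ[ℂ] 𝓢(EuclideanSpace ℝ (Fin n), ℂ) :=
  (SchwartzMap.smulLeftCLM ℂ
    (fun x : EuclideanSpace ℝ (Fin n) => ((inner ℝ v x : ℝ) : ℂ))).toLinearMap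

/-- The derivative of Schwartz functions in the direction `v`. -/
noncomputable def partialDeriv (v : EuclideanSpace ℝ (Fin n)) :
    𝓢(EuclideanSpace ℝ (Fin n), ℂ) →ₗ[ℂ] 𝓢(EuclideanSpace ℝ (Fin n), ℂ) :=
  (LineDeriv.lineDerivOpCLM ℂ 𝓢(EuclideanSpace ℝ (Fin n), ℂ) v).toLinearMap

/-- The inclusion of Schwartz functions into `L²`. -/
noncomputable def schwartzToL2 (n : ℕ) : 𝓢(EuclideanSpace ℝ (Fin n), ℂ) →ₗ[ℂ] L2Space n :=
  (SchwartzMap.toLpCLM ℂ ℂ 2 (volume : Measure (EuclideanSpace ℝ (Fin n)))).toLinearMap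

theorem schwartzToL2_apply (φ : 𝓢(EuclideanSpace ℝ (Fin n), ℂ)) :
    schwartzToL2 n φ = φ.toLp 2 volume := rfl

theorem coeFn_schwartzToL2 (φ : 𝓢(EuclideanSpace ℝ (Fin n), ℂ)) :
    schwartzToL2 n φ =ᵐ[volume] φ := φ.coeFn_toLp 2 volume

theorem schwartzToL2_injective : Function.Injective (schwartzToL2 n) :=
  SchwartzMap.injective_toLp 2 (volume : Measure (EuclideanSpace ℝ (Fin n)))

theorem inner_schwartzToL2 (φ ψ : 𝓢(EuclideanSpace ℝ (Fin n), ℂ)) :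
    inner ℂ (schwartzToL2 n φ) (schwartzToL2 n ψ) = ∫ x, inner ℂ (φ x) (ψ x) :=
  SchwartzMap.inner_toL2_toL2_eq φ ψ

theorem hasTemperateGrowth_inner_ofReal (v : EuclideanSpace ℝ (Fin n)) :
    (fun x : EuclideanSpace ℝ (Fin n) => ((inner ℝ v x : ℝ) : ℂ)).HasTemperateGrowth := by
  fun_prop

theorem position_apply (v : EuclideanSpace ℝ (Fin n)) (φ : 𝓢(EuclideanSpace ℝ (Fin n), ℂ))
    (x : EuclideanSpace ℝ (Fin n)) : position v φ x = ((inner ℝ v x : ℝ) : ℂ) * φ x :=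
  SchwartzMap.smulLeftCLM_apply_apply (hasTemperateGrowth_inner_ofReal v) φ x

theorem partialDeriv_apply (v : EuclideanSpace ℝ (Fin n))
    (φ : 𝓢(EuclideanSpace ℝ (Fin n), ℂ)) : partialDeriv v φ = ∂_{v} φ := rfl

theorem partialDeriv_apply_apply (v : EuclideanSpace ℝ (Fin n))
    (φ : 𝓢(EuclideanSpace ℝ (Fin n), ℂ)) (x : EuclideanSpace ℝ (Fin n)) :
    partialDeriv v φ x = fderiv ℝ φ x v := rfl

theorem position_comm (u v : EuclideanSpace ℝ (Fin n)) (φ : 𝓢(EuclideanSpace ℝ (Fin n), ℂ)) :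
    position u (position v φ) = position v (position u φ) := by
  ext x
  simp only [position_apply]
  ring

theorem partialDeriv_comm (u v : EuclideanSpace ℝ (Fin n))
    (φ : 𝓢(EuclideanSpace ℝ (Fin n), ℂ)) :
    partialDeriv u (partialDeriv v φ) = partialDeriv v (partialDeriv u φ) := by
  ext x
  have h : ∀ a b : EuclideanSpace ℝ (Fin n),
      partialDeriv a (partialDeriv b φ) x = fderiv ℝ (fderiv ℝ φ) x a b := by
    intro a b
    rw [partialDeriv_apply_apply]
    have hd : DifferentiableAt ℝ (fderiv ℝ φ) x :=
      ((φ.smooth 2).fderiv_right (m := 1) (by norm_num)).differentiable (by norm_num) x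
    have := (hd.hasFDerivAt.clm_apply (hasFDerivAt_const b x)).fderiv
    change fderiv ℝ (fun y => fderiv ℝ φ y b) x a = _
    rw [this]
    simp
  rw [h, h]
  have hs : IsSymmSndFDerivAt ℝ φ x :=
    (φ.smooth 2).contDiffAt.isSymmSndFDerivAt (by simp)
  exact hs u v

theorem partialDeriv_position (u v : EuclideanSpace ℝ (Fin n))
    (φ : 𝓢(EuclideanSpace ℝ (Fin n), ℂ)) :
    partialDeriv u (position v φ) = position v (partialDeriv u φ) + ((inner ℝ v u : ℝ) : ℂ) • φ := by
  ext x
  have h1 : HasFDerivAt (fun y : EuclideanSpace ℝ (Fin n) => ((inner ℝ v y : ℝ) : ℂ))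
      (Complex.ofRealCLM.comp (innerSL ℝ v)) x :=
    (Complex.ofRealCLM.comp (innerSL ℝ v)).hasFDerivAt
  have h2 := (h1.mul (φ.hasFDerivAt x)).fderiv
  have h3 : (position v φ : EuclideanSpace ℝ (Fin n) → ℂ) =
      fun y => ((inner ℝ v y : ℝ) : ℂ) * φ y := funext (position_apply v φ)
  rw [partialDeriv_apply_apply, h3, add_apply, smul_apply, position_apply,
    partialDeriv_apply_apply]
  erw [h2]
  simp [mul_comm]

theorem inner_position_left (v : EuclideanSpace ℝ (Fin n))
    (φ ψ : 𝓢(EuclideanSpace ℝ (Fin n), ℂ)) :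
    inner ℂ (schwartzToL2 n (position v φ)) (schwartzToL2 n ψ) =
      inner ℂ (schwartzToL2 n φ) (schwartzToL2 n (position v ψ)) := by
  simp only [inner_schwartzToL2, position_apply, RCLike.inner_apply, map_mul, Complex.conj_ofReal]
  congr 1
  ext x
  ring

/-- Complex conjugation of Schwartz functions. -/
noncomputable def schwartzConj (φ : 𝓢(EuclideanSpace ℝ (Fin n), ℂ)) :
    𝓢(EuclideanSpace ℝ (Fin n), ℂ) :=
  SchwartzMap.postcompCLM (𝕜 := ℝ) (Complex.conjCLE : ℂ →L[ℝ] ℂ) φ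

theorem schwartzConj_apply (φ : 𝓢(EuclideanSpace ℝ (Fin n), ℂ)) (x : EuclideanSpace ℝ (Fin n)) :
    schwartzConj φ x = conj (φ x) := rfl

theorem lineDerivOp_schwartzConj (v : EuclideanSpace ℝ (Fin n))
    (φ : 𝓢(EuclideanSpace ℝ (Fin n), ℂ)) :
    ∂_{v} (schwartzConj φ) = schwartzConj (∂_{v} φ) := by
  ext x
  have h := ((Complex.conjCLE : ℂ →L[ℝ] ℂ).hasFDerivAt.comp x (φ.hasFDerivAt x)).fderiv
  rw [SchwartzMap.lineDerivOp_apply_eq_fderiv, schwartzConj_apply,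
    SchwartzMap.lineDerivOp_apply_eq_fderiv]
  erw [h]
  rfl

/-- Integration by parts is bilinear, so it is applied to `ψ` and the conjugate of `φ`; conjugation
commutes with real directional derivatives. -/
theorem inner_partialDeriv_left (v : EuclideanSpace ℝ (Fin n))
    (φ ψ : 𝓢(EuclideanSpace ℝ (Fin n), ℂ)) :
    inner ℂ (schwartzToL2 n (partialDeriv v φ)) (schwartzToL2 n ψ) =
      -inner ℂ (schwartzToL2 n φ) (schwartzToL2 n (partialDeriv v ψ)) := by
  have h := SchwartzMap.integral_mul_lineDerivOp_right_eq_neg_left (μ := volume)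
    ψ (schwartzConj φ) v
  simp only [lineDerivOp_schwartzConj, schwartzConj_apply] at h
  simpa only [inner_schwartzToL2, RCLike.inner_apply, partialDeriv_apply] using h

end Operators

/-! ### Ladder operators and their commutation relations -/

section Ladder

variable {n : ℕ} (b : OrthonormalBasis (Fin n) ℝ (EuclideanSpace ℝ (Fin n))) (w : Fin n → ℝ)

/-- The creation operator `wᵢ xᵢ - ∂ᵢ` in the coordinates of an orthonormal basis. -/
noncomputable def raising (i : Fin n) :
    𝓢(EuclideanSpace ℝ (Fin n), ℂ) →ₗ[ℂ] 𝓢(EuclideanSpace ℝ (Fin n), ℂ) :=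
  (w i : ℂ) • position (b i) - partialDeriv (b i)

/-- The annihilation operator `wᵢ xᵢ + ∂ᵢ` in the coordinates of an orthonormal basis. -/
noncomputable def lowering (i : Fin n) :
    𝓢(EuclideanSpace ℝ (Fin n), ℂ) →ₗ[ℂ] 𝓢(EuclideanSpace ℝ (Fin n), ℂ) :=
  (w i : ℂ) • position (b i) + partialDeriv (b i)

/-- Multiplication by `∑ᵢ wᵢ² xᵢ²` on Schwartz functions. -/
noncomputable def schwartzPotential :
    𝓢(EuclideanSpace ℝ (Fin n), ℂ) →ₗ[ℂ] 𝓢(EuclideanSpace ℝ (Fin n), ℂ) :=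
  ∑ i, ((w i : ℂ) ^ 2) • (position (b i) ∘ₗ position (b i))

/-- The Laplacian on Schwartz functions, in the coordinates of an orthonormal basis. -/
noncomputable def schwartzLaplacian :
    𝓢(EuclideanSpace ℝ (Fin n), ℂ) →ₗ[ℂ] 𝓢(EuclideanSpace ℝ (Fin n), ℂ) :=
  ∑ i, partialDeriv (b i) ∘ₗ partialDeriv (b i)

/-- The harmonic oscillator on Schwartz functions. -/
noncomputable def schwartzOscillator :
    𝓢(EuclideanSpace ℝ (Fin n), ℂ) →ₗ[ℂ] 𝓢(EuclideanSpace ℝ (Fin n), ℂ) :=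
  -schwartzLaplacian b + schwartzPotential b w

theorem partialDeriv_position_basis (i j : Fin n) (φ : 𝓢(EuclideanSpace ℝ (Fin n), ℂ)) :
    partialDeriv (b i) (position (b j) φ) =
      position (b j) (partialDeriv (b i) φ) + (if i = j then (1 : ℂ) else 0) • φ := by
  rw [partialDeriv_position, b.inner_eq_ite]
  congr 2
  by_cases h : i = j
  · simp [h]
  · simp [h, Ne.symm h]

/-- Only `[∂ᵢ, xⱼ] = δᵢⱼ` contributes: both mixed terms give `wᵢ` when `i = j`. -/
theorem lowering_raising (i j : Fin n) (φ : 𝓢(EuclideanSpace ℝ (Fin n), ℂ)) :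
    lowering b w i (raising b w j φ) =
      raising b w j (lowering b w i φ) + (if i = j then 2 * (w i : ℂ) else 0) • φ := by
  have hQ := position_comm (b i) (b j) φ
  have hP := partialDeriv_comm (b i) (b j) φ
  have h1 := partialDeriv_position_basis b i j φ
  have h2 := partialDeriv_position_basis b j i φ
  simp only [lowering, raising, LinearMap.add_apply, LinearMap.sub_apply, LinearMap.smul_apply,
    map_add, map_sub, map_smul]
  rw [h1, h2, hQ, hP]
  by_cases h : i = j
  · subst h
    simp only [if_true]
    module
  · simp only [h, Ne.symm h, if_false]
    module

/-- Factorisation of each coordinate: `(wx - ∂)(wx + ∂) = w²x² - ∂² - w`, the `-w` coming from `∂x =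
x∂ + 1`. -/
theorem schwartzOscillator_eq_sum (φ : 𝓢(EuclideanSpace ℝ (Fin n), ℂ)) :
    schwartzOscillator b w φ =
      ∑ i, (raising b w i (lowering b w i φ) + (w i : ℂ) • φ) := by
  simp only [schwartzOscillator, schwartzLaplacian, schwartzPotential, LinearMap.add_apply,
    LinearMap.neg_apply, LinearMap.sum_apply, ← Finset.sum_neg_distrib, ← Finset.sum_add_distrib]
  refine Finset.sum_congr rfl fun i _ => ?_
  have h1 := partialDeriv_position_basis b i i φ
  simp only [lowering, raising, LinearMap.add_apply, LinearMap.sub_apply, LinearMap.smul_apply,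
    LinearMap.comp_apply, map_add, map_smul]
  rw [h1]
  simp only [if_true]
  module

theorem raising_comm (i j : Fin n) (φ : 𝓢(EuclideanSpace ℝ (Fin n), ℂ)) :
    raising b w i (raising b w j φ) = raising b w j (raising b w i φ) := by
  have hQ := position_comm (b i) (b j) φ
  have hP := partialDeriv_comm (b i) (b j) φ
  have h1 := partialDeriv_position_basis b i j φ
  have h2 := partialDeriv_position_basis b j i φ
  simp only [raising, LinearMap.sub_apply, LinearMap.smul_apply, map_sub, map_smul]
  rw [h1, h2, hQ, hP]
  by_cases h : i = j
  · subst h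
    module
  · simp only [h, Ne.symm h, if_false]
    module

theorem schwartzOscillator_raising (j : Fin n) (φ : 𝓢(EuclideanSpace ℝ (Fin n), ℂ)) :
    schwartzOscillator b w (raising b w j φ) =
      raising b w j (schwartzOscillator b w φ) + (2 * (w j : ℂ)) • raising b w j φ := by
  simp only [schwartzOscillator_eq_sum, lowering_raising, map_sum, map_add, map_smul,
    raising_comm b w _ j, Finset.sum_add_distrib, ite_smul, zero_smul]
  have : ∀ i, raising b w i (if i = j then (2 * (w i : ℂ)) • φ else 0) =
      if i = j then (2 * (w j : ℂ)) • raising b w j φ else 0 := by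
    intro i
    by_cases h : i = j
    · subst h; simp
    · simp [h]
  simp only [this, Finset.sum_ite_eq', Finset.mem_univ, if_true]
  module

theorem inner_raising_left (i : Fin n) (φ ψ : 𝓢(EuclideanSpace ℝ (Fin n), ℂ)) :
    inner ℂ (schwartzToL2 n (raising b w i φ)) (schwartzToL2 n ψ) =
      inner ℂ (schwartzToL2 n φ) (schwartzToL2 n (lowering b w i ψ)) := by
  simp only [raising, lowering, LinearMap.add_apply, LinearMap.sub_apply, LinearMap.smul_apply,
    map_add, map_sub, map_smul, inner_sub_left, inner_add_right, inner_smul_left, inner_smul_right,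
    inner_position_left, inner_partialDeriv_left, Complex.conj_ofReal]
  ring

theorem inner_lowering_left (i : Fin n) (φ ψ : 𝓢(EuclideanSpace ℝ (Fin n), ℂ)) :
    inner ℂ (schwartzToL2 n (lowering b w i φ)) (schwartzToL2 n ψ) =
      inner ℂ (schwartzToL2 n φ) (schwartzToL2 n (raising b w i ψ)) := by
  rw [← inner_conj_symm, ← inner_raising_left, inner_conj_symm]

/-- From `aa† = a†a + 2w` and adjointness. It makes `raising` injective for `wᵢ > 0`, so excited
states are nonzero without computing Hermite polynomials. -/
theorem norm_raising_sq (i : Fin n) (φ : 𝓢(EuclideanSpace ℝ (Fin n), ℂ)) :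
    ‖schwartzToL2 n (raising b w i φ)‖ ^ 2 =
      ‖schwartzToL2 n (lowering b w i φ)‖ ^ 2 + 2 * w i * ‖schwartzToL2 n φ‖ ^ 2 := by
  have h : (inner ℂ (schwartzToL2 n (raising b w i φ)) (schwartzToL2 n (raising b w i φ)) : ℂ) =
      inner ℂ (schwartzToL2 n (lowering b w i φ)) (schwartzToL2 n (lowering b w i φ)) +
        2 * w i * inner ℂ (schwartzToL2 n φ) (schwartzToL2 n φ) := by
    rw [inner_raising_left, lowering_raising, if_pos rfl, map_add, map_smul, inner_add_right,
      inner_smul_right, inner_lowering_left]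
  simp only [inner_self_eq_norm_sq_to_K, Complex.coe_algebraMap] at h
  exact_mod_cast h

theorem raising_ne_zero {i : Fin n} (hi : 0 < w i) {φ : 𝓢(EuclideanSpace ℝ (Fin n), ℂ)}
    (hφ : φ ≠ 0) : raising b w i φ ≠ 0 := by
  intro h
  have h1 := norm_raising_sq b w i φ
  rw [h, map_zero, norm_zero] at h1
  have h2 : 0 < ‖schwartzToL2 n φ‖ := by
    rw [norm_pos_iff]
    exact (map_ne_zero_iff _ schwartzToL2_injective).mpr hφ
  have h3 : 0 < 2 * w i * ‖schwartzToL2 n φ‖ ^ 2 := by positivity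
  nlinarith [sq_nonneg ‖schwartzToL2 n (lowering b w i φ)‖]

theorem schwartzOscillator_apply (φ : 𝓢(EuclideanSpace ℝ (Fin n), ℂ)) :
    schwartzOscillator b w φ = -schwartzLaplacian b φ + schwartzPotential b w φ := rfl

theorem inner_schwartzOscillator_left (φ ψ : 𝓢(EuclideanSpace ℝ (Fin n), ℂ)) :
    inner ℂ (schwartzToL2 n (schwartzOscillator b w φ)) (schwartzToL2 n ψ) =
      inner ℂ (schwartzToL2 n φ) (schwartzToL2 n (schwartzOscillator b w ψ)) := by
  simp only [schwartzOscillator_eq_sum, map_sum, map_add, map_smul, sum_inner, inner_sum,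
    inner_add_left, inner_add_right, inner_raising_left, inner_lowering_left, inner_smul_left,
    inner_smul_right, Complex.conj_ofReal]

end Ladder

/-! ### A priori bound separating potential and Laplacian -/

section Estimate

variable {n : ℕ} (b : OrthonormalBasis (Fin n) ℝ (EuclideanSpace ℝ (Fin n))) (w : Fin n → ℝ)

/-- Integrating by parts shows that `⟨x∂φ, φ⟩` plus its conjugate is `-‖φ‖²`. -/
theorem re_inner_position_partialDeriv (i : Fin n) (φ : 𝓢(EuclideanSpace ℝ (Fin n), ℂ)) :
    (inner ℂ (schwartzToL2 n (position (b i) (partialDeriv (b i) φ))) (schwartzToL2 n φ) : ℂ).re =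
      -(1 / 2) * ‖schwartzToL2 n φ‖ ^ 2 := by
  have h1 : (inner ℂ (schwartzToL2 n (position (b i) (partialDeriv (b i) φ)))
      (schwartzToL2 n φ) : ℂ) =
      -(inner ℂ (schwartzToL2 n φ) (schwartzToL2 n (position (b i) (partialDeriv (b i) φ))) +
        inner ℂ (schwartzToL2 n φ) (schwartzToL2 n φ)) := by
    rw [inner_position_left, inner_partialDeriv_left, partialDeriv_position_basis, if_pos rfl,
      one_smul, map_add, inner_add_right]
  rw [← inner_conj_symm (schwartzToL2 n φ) (schwartzToL2 n (position _ _)),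
    inner_self_eq_norm_sq_to_K] at h1
  have h2 := congrArg Complex.re h1
  have h3 : ((‖schwartzToL2 n φ‖ : ℂ) ^ 2).re = ‖schwartzToL2 n φ‖ ^ 2 := by
    norm_cast
  rw [Complex.neg_re, Complex.add_re, Complex.conj_re] at h2
  erw [h3] at h2
  linarith

/-- Moving one `∂ᵢ` and one `xⱼ` across gives `-‖xⱼ∂ᵢφ‖² - 2δᵢⱼ⟨xⱼ∂ᵢφ, φ⟩`. The first term has the
good sign; by the previous lemma the second contributes at most `‖φ‖²`. -/
theorem re_inner_laplacian_position_le (i j : Fin n) (φ : 𝓢(EuclideanSpace ℝ (Fin n), ℂ)) :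
    (inner ℂ (schwartzToL2 n (partialDeriv (b i) (partialDeriv (b i) φ)))
      (schwartzToL2 n (position (b j) (position (b j) φ))) : ℂ).re ≤ ‖schwartzToL2 n φ‖ ^ 2 := by
  have h1 : (inner ℂ (schwartzToL2 n (partialDeriv (b i) (partialDeriv (b i) φ)))
      (schwartzToL2 n (position (b j) (position (b j) φ))) : ℂ) =
      -(inner ℂ (schwartzToL2 n (position (b j) (partialDeriv (b i) φ)))
          (schwartzToL2 n (position (b j) (partialDeriv (b i) φ))) +
        2 * (if i = j then (1 : ℂ) else 0) *
          inner ℂ (schwartzToL2 n (position (b j) (partialDeriv (b i) φ))) (schwartzToL2 n φ)) := by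
    rw [inner_partialDeriv_left, partialDeriv_position_basis, partialDeriv_position_basis]
    simp only [map_add, map_smul, inner_add_right, inner_smul_right, inner_position_left]
    ring
  rw [h1, inner_self_eq_norm_sq_to_K]
  have h3 : ∀ r : ℝ, ((r : ℂ) ^ 2).re = r ^ 2 := fun r => by norm_cast
  rw [Complex.neg_re, Complex.add_re]
  erw [h3]
  by_cases h : i = j
  · subst h
    have h4 := re_inner_position_partialDeriv b i φ
    rw [if_pos rfl, mul_one, show (2 : ℂ) = ((2 : ℝ) : ℂ) by norm_num, Complex.re_ofReal_mul, h4]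
    nlinarith [sq_nonneg ‖schwartzToL2 n (position (b i) (partialDeriv (b i) φ))‖]
  · rw [if_neg h]
    simp only [mul_zero, zero_mul, Complex.zero_re]
    nlinarith [sq_nonneg ‖schwartzToL2 n (position (b j) (partialDeriv (b i) φ))‖,
      sq_nonneg ‖schwartzToL2 n φ‖]

/-- Expand `‖-Δφ + Vφ‖²`, bound the cross term pair by pair with the previous lemma, and drop
`‖Δφ‖²`. -/
theorem norm_schwartzPotential_sq_le (φ : 𝓢(EuclideanSpace ℝ (Fin n), ℂ)) :
    ‖schwartzToL2 n (schwartzPotential b w φ)‖ ^ 2 ≤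
      ‖schwartzToL2 n (schwartzOscillator b w φ)‖ ^ 2 +
        2 * n * (∑ i, w i ^ 2) * ‖schwartzToL2 n φ‖ ^ 2 := by
  have h1 : (inner ℂ (schwartzToL2 n (schwartzLaplacian b φ))
      (schwartzToL2 n (schwartzPotential b w φ)) : ℂ).re ≤
        n * (∑ i, w i ^ 2) * ‖schwartzToL2 n φ‖ ^ 2 := by
    simp only [schwartzLaplacian, schwartzPotential, LinearMap.sum_apply, LinearMap.smul_apply,
      LinearMap.comp_apply, map_sum, map_smul, sum_inner, inner_sum, inner_smul_right,
      Complex.re_sum, Finset.mul_sum]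
    calc _ ≤ ∑ i : Fin n, ∑ j : Fin n, w i ^ 2 * ‖schwartzToL2 n φ‖ ^ 2 := by
          refine Finset.sum_le_sum fun i _ => Finset.sum_le_sum fun j _ => ?_
          rw [← Complex.ofReal_pow, Complex.re_ofReal_mul]
          exact mul_le_mul_of_nonneg_left (re_inner_laplacian_position_le b _ _ φ) (sq_nonneg _)
      _ = _ := by
          simp only [Finset.sum_const, Finset.card_univ, Fintype.card_fin, nsmul_eq_mul,
            ← Finset.sum_mul, ← Finset.mul_sum]
          ring
  have h2 : ‖schwartzToL2 n (schwartzOscillator b w φ)‖ ^ 2 =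
      ‖schwartzToL2 n (schwartzLaplacian b φ)‖ ^ 2 - 2 * (inner ℂ (schwartzToL2 n
        (schwartzLaplacian b φ)) (schwartzToL2 n (schwartzPotential b w φ)) : ℂ).re +
        ‖schwartzToL2 n (schwartzPotential b w φ)‖ ^ 2 := by
    rw [schwartzOscillator_apply, map_add, map_neg, neg_add_eq_sub, norm_sub_rev]
    exact norm_sub_sq (𝕜 := ℂ) _ _
  rw [h2]
  nlinarith [sq_nonneg ‖schwartzToL2 n (schwartzLaplacian b φ)‖]

end Estimate

/-! ### Excited states -/

section Excited

variable {n : ℕ} (b : OrthonormalBasis (Fin n) ℝ (EuclideanSpace ℝ (Fin n))) (w : Fin n → ℝ)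

/-- The functions obtained from a ground state `g` by `kᵢ` applications of the `i`-th creation
operator, in any order. -/
inductive IsExcited (g : 𝓢(EuclideanSpace ℝ (Fin n), ℂ)) :
    (Fin n → ℕ) → 𝓢(EuclideanSpace ℝ (Fin n), ℂ) → Prop
  | ground : IsExcited g 0 g
  | raise {k : Fin n → ℕ} {φ : 𝓢(EuclideanSpace ℝ (Fin n), ℂ)} (i : Fin n)
      (h : IsExcited g k φ) : IsExcited g (k + Pi.single i 1) (raising b w i φ)

/-- The energy `∑ᵢ (2 kᵢ + 1) wᵢ`. -/
noncomputable def energy (k : Fin n → ℕ) : ℝ := ∑ i, (2 * (k i : ℝ) + 1) * w i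

theorem energy_add_single (k : Fin n → ℕ) (i : Fin n) :
    energy w (k + Pi.single i 1) = energy w k + 2 * w i := by
  have : ∀ j, (2 * (((k + Pi.single i 1 : Fin n → ℕ) j : ℕ) : ℝ) + 1) * w j =
      (2 * (k j : ℝ) + 1) * w j + if j = i then 2 * w i else 0 := by
    intro j
    by_cases h : j = i
    · subst h; simp; ring
    · simp [h]
  simp only [energy, this, Finset.sum_add_distrib, Finset.sum_ite_eq', Finset.mem_univ, if_true]

variable {b w} {g : 𝓢(EuclideanSpace ℝ (Fin n), ℂ)}

theorem IsExcited.schwartzOscillator_eq (hg : ∀ i, lowering b w i g = 0) {k : Fin n → ℕ}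
    {φ : 𝓢(EuclideanSpace ℝ (Fin n), ℂ)}
    (h : IsExcited b w g k φ) : schwartzOscillator b w φ = ((energy w k : ℝ) : ℂ) • φ := by
  induction h with
  | ground =>
    simp only [schwartzOscillator_eq_sum, hg, map_zero, zero_add, ← Finset.sum_smul, energy]
    simp
  | raise i h ih =>
    rw [schwartzOscillator_raising, ih, energy_add_single, map_smul, ← add_smul]
    push_cast
    rfl

/-- Commute `lowering` past the raisings one at a time until it reaches and kills `g`; every
commutator is a multiple of an excited state. -/
theorem IsExcited.lowering_mem_span (hg : ∀ i, lowering b w i g = 0) {k : Fin n → ℕ}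
    {φ : 𝓢(EuclideanSpace ℝ (Fin n), ℂ)}
    (h : IsExcited b w g k φ) (i : Fin n) :
    lowering b w i φ ∈ Submodule.span ℂ {ψ | ∃ l, IsExcited b w g l ψ} := by
  induction h with
  | ground => simp [hg]
  | raise j h ih =>
    rw [lowering_raising]
    refine Submodule.add_mem _ ?_ (Submodule.smul_mem _ _ (Submodule.subset_span ⟨_, h⟩))
    refine Submodule.span_induction ?_ ?_ ?_ ?_ ih
    · rintro ψ ⟨l, hl⟩
      exact Submodule.subset_span ⟨_, hl.raise j⟩
    · simp
    · intro x y _ _ hx hy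
      rw [map_add]
      exact Submodule.add_mem _ hx hy
    · intro c x _ hx
      rw [map_smul]
      exact Submodule.smul_mem _ _ hx

/-- Since `xᵢ = (aᵢ† + aᵢ) / (2wᵢ)` and both ladder operators preserve the span. This is what brings
polynomials times `g` into the span. -/
theorem position_mem_span_isExcited (hg : ∀ i, lowering b w i g = 0) (hw : ∀ i, 0 < w i)
    (v : EuclideanSpace ℝ (Fin n))
    {φ : 𝓢(EuclideanSpace ℝ (Fin n), ℂ)}
    (h : φ ∈ Submodule.span ℂ {ψ | ∃ l, IsExcited b w g l ψ}) :
    position v φ ∈ Submodule.span ℂ {ψ | ∃ l, IsExcited b w g l ψ} := by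
  have h0 : ∀ i, ∀ ψ ∈ Submodule.span ℂ {ψ | ∃ l, IsExcited b w g l ψ},
      position (b i) ψ ∈ Submodule.span ℂ {ψ | ∃ l, IsExcited b w g l ψ} := by
    intro i ψ hψ
    induction hψ using Submodule.span_induction with
    | mem ψ hψ =>
      obtain ⟨l, hl⟩ := hψ
      have h1 : position (b i) ψ =
          (2 * (w i : ℂ))⁻¹ • (raising b w i ψ + lowering b w i ψ) := by
        have : (2 * (w i : ℂ)) ≠ 0 := by simp [(hw i).ne']
        rw [eq_inv_smul_iff₀ this]
        simp only [raising, lowering, LinearMap.add_apply, LinearMap.sub_apply,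
          LinearMap.smul_apply]
        module
      rw [h1]
      exact Submodule.smul_mem _ _ (Submodule.add_mem _ (Submodule.subset_span ⟨_, hl.raise i⟩)
        (hl.lowering_mem_span hg i))
    | zero => simp
    | add x y _ _ hx hy =>
      rw [map_add]
      exact Submodule.add_mem _ hx hy
    | smul c x _ hx =>
      rw [map_smul]
      exact Submodule.smul_mem _ _ hx
  have h1 : position v φ = ∑ i, ((inner ℝ (b i) v : ℝ) : ℂ) • position (b i) φ := by
    ext x
    have hs : (∑ i, ((inner ℝ (b i) v : ℝ) : ℂ) • position (b i) φ) x =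
        ∑ i, ((inner ℝ (b i) v : ℝ) : ℂ) * (position (b i) φ x) := by
      simp
    rw [hs]
    simp only [position_apply, ← mul_assoc, ← Finset.sum_mul]
    congr 1
    rw [← b.sum_inner_mul_inner v x]
    push_cast
    exact Finset.sum_congr rfl fun i _ => by rw [real_inner_comm]
  rw [h1]
  exact Submodule.sum_mem _ fun i _ => Submodule.smul_mem _ _ (h0 i φ h)

theorem exists_isExcited_ne_zero (hw : ∀ i, 0 < w i) (hg0 : g ≠ 0) (k : Fin n → ℕ) :
    ∃ φ, IsExcited b w g k φ ∧ φ ≠ 0 := by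
  induction hm : ∑ i, k i generalizing k with
  | zero =>
    have : k = 0 := by
      ext i
      simpa using Finset.sum_eq_zero_iff.mp hm i
    subst this
    exact ⟨g, .ground, hg0⟩
  | succ m ih =>
    have : ∃ i, k i ≠ 0 := by
      by_contra! h
      simp [h] at hm
    obtain ⟨i, hi⟩ := this
    have hk : k = Function.update k i (k i - 1) + Pi.single i 1 := by
      ext j
      by_cases h : j = i
      · subst h; simp; omega
      · simp [h]
    have hs : ∑ j, Function.update k i (k i - 1) j = m := by
      have h1 : ∑ j, k j = ∑ j, Function.update k i (k i - 1) j + 1 := by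
        conv_lhs => rw [hk]
        simp [Finset.sum_add_distrib]
      omega
    obtain ⟨φ, hφ, hφ0⟩ := ih _ hs
    rw [hk]
    exact ⟨_, hφ.raise i, raising_ne_zero b w (hw i) hφ0⟩

end Excited

end HarmonicOscillator

namespace HarmonicOscillator

open scoped LineDeriv ComplexConjugate ContDiff Nat

/-! ### Exponentials that are Schwartz functions -/

section Gaussian

theorem exists_pow_mul_exp_neg_le (m : ℕ) {c : ℝ} (hc : 0 < c) :
    ∃ M : ℝ, ∀ r : ℝ, 0 ≤ r → (1 + r) ^ m * Real.exp (-(c * r)) ≤ M := by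
  -- The constant is `yᵐ / m! ≤ eʸ` at `y = c(1 + r)`.
  refine ⟨m ! * Real.exp c / c ^ m, fun r hr => ?_⟩
  have h := Real.pow_div_factorial_le_exp (c * (1 + r)) (by positivity) m
  rw [mul_add, mul_one, Real.exp_add, div_le_iff₀ (by positivity), ← mul_one_add, mul_pow] at h
  rw [Real.exp_neg, le_div_iff₀ (by positivity), ← div_eq_mul_inv, div_mul_eq_mul_div,
    div_le_iff₀ (by positivity)]
  linarith

variable {E : Type*} [NormedAddCommGroup E] [NormedSpace ℝ E]

/-- The function `exp(-f)` as a Schwartz function, if `f` has temperate growth and grows at least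
linearly. -/
noncomputable def schwartzExpNeg (f : E → ℝ) (hf : f.HasTemperateGrowth) {c d : ℝ} (hc : 0 < c)
    (h : ∀ x, c * ‖x‖ ≤ f x + d) : 𝓢(E, ℝ) where
  toFun := Real.exp ∘ (-f)
  smooth' := Real.contDiff_exp.comp hf.neg.1
  decay' k m := by
    obtain ⟨l, C, hC0, hC⟩ := hf.neg.norm_iteratedFDeriv_le_uniform m
    obtain ⟨M, hM⟩ := exists_pow_mul_exp_neg_le (k + l * m) hc
    refine ⟨m ! * Real.exp d * (C + 1) ^ m * M, fun x => ?_⟩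
    -- The bound for derivatives of a composition wants the `i`-th derivative of the inner function
    -- below `Dⁱ`. Using `C + 1` instead of `C` makes `D ≥ 1`, so a bound by `D` suffices for `i ≥
    -- 1`.
    have hD1 : 1 ≤ (C + 1) * (1 + ‖x‖) ^ l :=
      one_le_mul_of_one_le_of_one_le (by linarith) (one_le_pow₀ (by linarith [norm_nonneg x]))
    have h1 := norm_iteratedFDeriv_comp_le (𝕜 := ℝ) (N := ∞) (n := m) Real.contDiff_exp
      hf.neg.1 (by exact_mod_cast le_top) x (C := Real.exp ((-f) x)) (D := (C + 1) * (1 + ‖x‖) ^ l)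
      (fun i _ => by
        rw [norm_iteratedFDeriv_eq_norm_iteratedDeriv, iteratedDeriv_eq_iterate,
          Real.iter_deriv_exp, Real.norm_eq_abs, Real.abs_exp])
      (fun i hi him => (hC i him x).trans <| by
        calc C * (1 + ‖x‖) ^ l ≤ (C + 1) * (1 + ‖x‖) ^ l := by gcongr; linarith
          _ ≤ ((C + 1) * (1 + ‖x‖) ^ l) ^ i := le_self_pow₀ hD1 (by omega))
    have h2 : Real.exp ((-f) x) ≤ Real.exp d * Real.exp (-(c * ‖x‖)) := by
      rw [← Real.exp_add]
      refine Real.exp_le_exp.mpr ?_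
      simp only [Pi.neg_apply]
      linarith [h x]
    have h3 : ‖x‖ ^ k ≤ (1 + ‖x‖) ^ k := by gcongr; linarith
    calc ‖x‖ ^ k * ‖iteratedFDeriv ℝ m (Real.exp ∘ (-f)) x‖
        ≤ (1 + ‖x‖) ^ k * (m ! * (Real.exp d * Real.exp (-(c * ‖x‖))) *
            ((C + 1) * (1 + ‖x‖) ^ l) ^ m) := by
          refine mul_le_mul h3 (h1.trans ?_) (norm_nonneg _) (by positivity)
          gcongr
      _ = m ! * Real.exp d * (C + 1) ^ m *
            ((1 + ‖x‖) ^ (k + l * m) * Real.exp (-(c * ‖x‖))) := by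
          rw [mul_pow, ← pow_mul, pow_add]
          ring
      _ ≤ m ! * Real.exp d * (C + 1) ^ m * M := by
          gcongr
          exact hM _ (norm_nonneg x)

theorem schwartzExpNeg_apply (f : E → ℝ) (hf : f.HasTemperateGrowth) {c d : ℝ} (hc : 0 < c)
    (h : ∀ x, c * ‖x‖ ≤ f x + d) (x : E) : schwartzExpNeg f hf hc h x = Real.exp (-f x) := rfl

end Gaussian

/-! ### The Gaussian ground state -/

section GroundState

variable {n : ℕ} (b : OrthonormalBasis (Fin n) ℝ (EuclideanSpace ℝ (Fin n))) (w : Fin n → ℝ)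

/-- The quadratic exponent `∑ᵢ wᵢ xᵢ² / 2` of the ground state. -/
noncomputable def groundExponent (x : EuclideanSpace ℝ (Fin n)) : ℝ :=
  ∑ i, w i / 2 * (inner ℝ (b i) x : ℝ) ^ 2

theorem hasTemperateGrowth_groundExponent : (groundExponent b w).HasTemperateGrowth := by
  refine Function.HasTemperateGrowth.sum fun i _ => ?_
  exact (Function.HasTemperateGrowth.const (w i / 2)).mul
    ((Function.hasTemperateGrowth_inner_right (b i)).pow 2)

variable {w} in
theorem exists_le_groundExponent (hw : ∀ i, 0 < w i) :
    ∃ c : ℝ, 0 < c ∧ ∀ x, c * ‖x‖ ^ 2 ≤ groundExponent b w x := by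
  have hs : 0 ≤ ∑ i, (w i)⁻¹ := Finset.sum_nonneg fun i _ => (inv_pos.mpr (hw i)).le
  -- A positive lower bound for all `wᵢ / 2` that avoids a minimum and so also makes sense for `n =
  -- 0`.
  refine ⟨(1 + ∑ i, (w i)⁻¹)⁻¹ / 2, by positivity, fun x => ?_⟩
  rw [← b.sum_sq_norm_inner_right x, Finset.mul_sum]
  refine Finset.sum_le_sum fun i _ => ?_
  rw [Real.norm_eq_abs, sq_abs]
  have h1 : (w i)⁻¹ ≤ 1 + ∑ i, (w i)⁻¹ :=
    (Finset.single_le_sum (f := fun i => (w i)⁻¹) (fun j _ => (inv_pos.mpr (hw j)).le)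
      (Finset.mem_univ i)).trans (by linarith)
  have h2 := inv_anti₀ (inv_pos.mpr (hw i)) h1
  rw [inv_inv] at h2
  gcongr

variable {w} in
theorem exists_linear_le_groundExponent (hw : ∀ i, 0 < w i) (v : EuclideanSpace ℝ (Fin n)) :
    ∃ d : ℝ, ∀ x, 1 * ‖x‖ ≤ (groundExponent b w x - inner ℝ v x) + d := by
  obtain ⟨c, hc, h⟩ := exists_le_groundExponent b hw
  -- The maximum of `(1 + ‖v‖) r - c r²` over real `r`, found by completing the square.
  refine ⟨(1 + ‖v‖) ^ 2 / (4 * c), fun x => ?_⟩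
  have h1 := h x
  have h2 := real_inner_le_norm v x
  have h3 : (1 + ‖v‖) * ‖x‖ ≤ c * ‖x‖ ^ 2 + (1 + ‖v‖) ^ 2 / (4 * c) := by
    have : c * ‖x‖ ^ 2 + (1 + ‖v‖) ^ 2 / (4 * c) - (1 + ‖v‖) * ‖x‖ =
        (2 * c * ‖x‖ - (1 + ‖v‖)) ^ 2 / (4 * c) := by
      field_simp
      ring
    have h4 : 0 ≤ (2 * c * ‖x‖ - (1 + ‖v‖)) ^ 2 / (4 * c) := by positivity
    linarith
  linarith

variable {w}

/-- The Gaussian `exp(-∑ᵢ wᵢ xᵢ² / 2 + ⟨v, x⟩)` as a Schwartz function. -/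
noncomputable def shiftedGaussian (hw : ∀ i, 0 < w i) (v : EuclideanSpace ℝ (Fin n)) :
    𝓢(EuclideanSpace ℝ (Fin n), ℝ) :=
  schwartzExpNeg (fun x => groundExponent b w x - inner ℝ v x)
    ((hasTemperateGrowth_groundExponent b w).sub (Function.hasTemperateGrowth_inner_right v))
    one_pos (exists_linear_le_groundExponent b hw v).choose_spec

theorem shiftedGaussian_apply (hw : ∀ i, 0 < w i) (v x : EuclideanSpace ℝ (Fin n)) :
    shiftedGaussian b hw v x = Real.exp (-(groundExponent b w x) + inner ℝ v x) := by
  rw [shiftedGaussian, schwartzExpNeg_apply, neg_sub, neg_add_eq_sub]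

/-- The ground state `exp(-∑ᵢ wᵢ xᵢ² / 2)`. -/
noncomputable def groundState (hw : ∀ i, 0 < w i) : 𝓢(EuclideanSpace ℝ (Fin n), ℂ) :=
  SchwartzMap.postcompCLM (𝕜 := ℝ) Complex.ofRealCLM (shiftedGaussian b hw 0)

theorem groundState_apply (hw : ∀ i, 0 < w i) (x : EuclideanSpace ℝ (Fin n)) :
    groundState b hw x = (Real.exp (-(groundExponent b w x)) : ℂ) := by
  rw [groundState, SchwartzMap.postcompCLM_apply, shiftedGaussian_apply]
  simp

theorem groundState_ne_zero (hw : ∀ i, 0 < w i) : groundState b hw ≠ 0 := by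
  intro h
  have h1 := groundState_apply b hw 0
  rw [h] at h1
  exact (Real.exp_pos _).ne' (Complex.ofReal_eq_zero.mp h1.symm)

theorem hasFDerivAt_groundExponent (x : EuclideanSpace ℝ (Fin n)) :
    HasFDerivAt (groundExponent b w)
      (∑ i, (w i * inner ℝ (b i) x) • innerSL ℝ (b i)) x := by
  have h : ∀ i ∈ Finset.univ, HasFDerivAt
      (fun x : EuclideanSpace ℝ (Fin n) => w i / 2 * (inner ℝ (b i) x : ℝ) ^ 2)
      ((w i * inner ℝ (b i) x) • innerSL ℝ (b i)) x := by
    intro i _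
    have h1 : HasFDerivAt (fun x : EuclideanSpace ℝ (Fin n) => (inner ℝ (b i) x : ℝ))
      (innerSL ℝ (b i)) x := (innerSL ℝ (b i)).hasFDerivAt
    convert! (h1.pow 2).const_mul (w i / 2) using 1
    rw [smul_smul]
    congr 1
    simp
    ring
  exact HasFDerivAt.fun_sum h

theorem lowering_groundState (hw : ∀ i, 0 < w i) (i : Fin n) :
    lowering b w i (groundState b hw) = 0 := by
  ext x
  have h1 := (Complex.ofRealCLM.hasFDerivAt.comp x
    (hasFDerivAt_groundExponent b (w := w) x).neg.exp).fderiv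
  have h2 : (groundState b hw : EuclideanSpace ℝ (Fin n) → ℂ) =
      Complex.ofRealCLM ∘ fun x => Real.exp (-groundExponent b w x) :=
    funext fun x => groundState_apply b hw x
  have h3 : ∑ j, w j * (inner ℝ (b j) x : ℝ) * inner ℝ (b j) (b i) =
      w i * inner ℝ (b i) x := by
    simp [b.inner_eq_ite]
  have h4 : (lowering b w i (groundState b hw)) x = (w i : ℂ) * position (b i) (groundState b hw) x
      + partialDeriv (b i) (groundState b hw) x := rfl
  rw [h4, partialDeriv_apply_apply, h2]
  erw [h1]
  rw [position_apply, groundState_apply]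
  simp only [ContinuousLinearMap.comp_apply, smul_apply,
    neg_apply, sum_apply, innerSL_apply_apply, smul_eq_mul,
    h3, Complex.ofRealCLM_apply]
  push_cast
  simp
  ring

end GroundState

end HarmonicOscillator

namespace HarmonicOscillator

open scoped LineDeriv ComplexConjugate ContDiff FourierTransform

/-! ### Injectivity of the Fourier transform on integrable functions -/

section Fourier

/-- An integrable function with vanishing Fourier transform is zero. -/
theorem ae_eq_zero_of_fourier_eq_zero {V : Type*} [NormedAddCommGroup V] [InnerProductSpace ℝ V]
    [FiniteDimensional ℝ V] [MeasurableSpace V] [BorelSpace V] {f : V → ℂ}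
    (hf : Integrable f) (h : ∀ ξ, 𝓕 f ξ = 0) : f =ᵐ[volume] 0 := by
  refine ae_eq_zero_of_integral_contDiff_smul_eq_zero hf.locallyIntegrable fun χ hχ hχc => ?_
  have hχ₁ : HasCompactSupport (Complex.ofRealCLM ∘ χ) := hχc.comp_left rfl
  have hχ₂ : ContDiff ℝ ∞ (Complex.ofRealCLM ∘ χ) := by fun_prop
  set χ' : 𝓢(V, ℂ) := hχ₁.toSchwartzMap hχ₂
  -- Write the test function as the transform of `𝓕⁻ χ'` and shift the transform onto `f`, where it
  -- vanishes.
  have h1 := VectorFourier.integral_fourierIntegral_smul_eq_flip (e := Real.fourierChar)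
    (μ := volume) (ν := volume) (L := innerₗ V) (f := (𝓕⁻ χ' : 𝓢(V, ℂ))) (g := f)
    Real.continuous_fourierChar continuous_inner (SchwartzMap.integrable _) hf
  have h2 : ∀ ξ, VectorFourier.fourierIntegral Real.fourierChar volume (innerₗ V)
      (𝓕⁻ χ' : 𝓢(V, ℂ)) ξ = (χ ξ : ℂ) := by
    intro ξ
    have : (𝓕 (𝓕⁻ χ') : 𝓢(V, ℂ)) ξ = (χ ξ : ℂ) := by
      rw [FourierTransform.fourier_fourierInv_eq]
      rfl
    rw [← this, SchwartzMap.fourier_coe]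
    rfl
  have h3 : ∀ ξ, VectorFourier.fourierIntegral Real.fourierChar volume (innerₗ V).flip f ξ = 0 := by
    intro ξ
    rw [flip_innerₗ]
    exact h ξ
  simp only [h2, h3, smul_zero, integral_zero] at h1
  simpa using h1

end Fourier

/-! ### Completeness of polynomials times the Gaussian -/

section Completeness

variable {n : ℕ} (b : OrthonormalBasis (Fin n) ℝ (EuclideanSpace ℝ (Fin n))) {w : Fin n → ℝ}

theorem position_pow_apply (v : EuclideanSpace ℝ (Fin n)) (m : ℕ)
    (φ : 𝓢(EuclideanSpace ℝ (Fin n), ℂ)) (x : EuclideanSpace ℝ (Fin n)) :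
    ((position v)^[m] φ) x = ((inner ℝ v x : ℝ) : ℂ) ^ m * φ x := by
  induction m with
  | zero => simp
  | succ m ih =>
    rw [Function.iterate_succ_apply', position_apply, ih]
    ring

theorem integrable_schwartz_mul (φ : 𝓢(EuclideanSpace ℝ (Fin n), ℝ)) (u : L2Space n) :
    Integrable fun x => φ x * ‖u x‖ :=
  (φ.memLp 2 volume).integrable_mul (Lp.memLp u).norm

theorem inner_position_pow_groundState (hw : ∀ i, 0 < w i) (u : L2Space n)
    (v : EuclideanSpace ℝ (Fin n)) (m : ℕ) :
    inner ℂ (schwartzToL2 n ((position v)^[m] (groundState b hw))) u =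
      ∫ x, ((inner ℝ v x : ℝ) : ℂ) ^ m * ((Real.exp (-(groundExponent b w x)) : ℂ) * u x) := by
  rw [L2.inner_def]
  refine integral_congr_ae ?_
  filter_upwards [coeFn_schwartzToL2 ((position v)^[m] (groundState b hw))] with x hx
  rw [hx, position_pow_apply, groundState_apply, RCLike.inner_apply, map_mul, map_pow,
    Complex.conj_ofReal]
  have : conj ((Real.exp (-(groundExponent b w x)) : ℝ) : ℂ) =
      (Real.exp (-(groundExponent b w x)) : ℝ) := Complex.conj_ofReal _
  rw [this]
  ring

theorem integrable_groundState_mul (hw : ∀ i, 0 < w i) (u : L2Space n) :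
    Integrable fun x => (Real.exp (-(groundExponent b w x)) : ℂ) * u x := by
  have h := ((groundState b hw).memLp 2 volume).integrable_mul (Lp.memLp u)
  refine h.congr (Filter.Eventually.of_forall fun x => ?_)
  simp only [Pi.mul_apply, groundState_apply]

/-- The products of the ground state with powers of linear forms are complete in `L²`. -/
theorem eq_zero_of_inner_position_pow_groundState (hw : ∀ i, 0 < w i) (u : L2Space n)
    (h : ∀ (v : EuclideanSpace ℝ (Fin n)) (m : ℕ),
      inner ℂ (schwartzToL2 n ((position v)^[m] (groundState b hw))) u = 0) : u = 0 := by
  set G : EuclideanSpace ℝ (Fin n) → ℂ :=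
    fun x => (Real.exp (-(groundExponent b w x)) : ℂ) * u x with hG
  have hGint : Integrable G := integrable_groundState_mul b hw u
  have hzero : G =ᵐ[volume] 0 := by
    refine ae_eq_zero_of_fourier_eq_zero hGint fun ξ => ?_
    -- This dominates the exponential series of the Fourier kernel. By `e^|t| ≤ eᵗ + e⁻ᵗ` it reduces
    -- to two shifted Gaussians, each integrable against `‖u‖`.
    have hdom : Integrable fun x : EuclideanSpace ℝ (Fin n) =>
        Real.exp (2 * Real.pi * |(inner ℝ ξ x : ℝ)|) * ‖G x‖ := by
      refine ((integrable_schwartz_mul (shiftedGaussian b hw ((2 * Real.pi) • ξ)) u).add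
        (integrable_schwartz_mul (shiftedGaussian b hw (-((2 * Real.pi) • ξ))) u)).mono'
        ?_ (Filter.Eventually.of_forall fun x => ?_)
      · exact (Continuous.aestronglyMeasurable (by fun_prop)).mul hGint.1.norm
      · have hn : ‖G x‖ = Real.exp (-(groundExponent b w x)) * ‖u x‖ := by
          rw [hG, norm_mul, Complex.norm_real, Real.norm_eq_abs, Real.abs_exp]
        rw [Real.norm_of_nonneg (by positivity), hn]
        simp only [Pi.add_apply, shiftedGaussian_apply, inner_neg_left, real_inner_smul_left,
          Real.exp_add]
        have h1 : Real.exp (2 * Real.pi * |(inner ℝ ξ x : ℝ)|) ≤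
            Real.exp (2 * Real.pi * inner ℝ ξ x) + Real.exp (-(2 * Real.pi * inner ℝ ξ x)) := by
          rcases abs_cases (inner ℝ ξ x : ℝ) with h | h
          · rw [h.1]
            linarith [Real.exp_pos (-(2 * Real.pi * inner ℝ ξ x))]
          · rw [h.1, mul_neg]
            linarith [Real.exp_pos (2 * Real.pi * inner ℝ ξ x)]
        have h2 : 0 ≤ Real.exp (-(groundExponent b w x)) * ‖u x‖ := by positivity
        nlinarith [mul_le_mul_of_nonneg_right h1 h2]
    -- The Fourier integral of `G` at `ξ` is summed term by term; each term is a multiple of a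
    -- moment of `G`, which vanishes by hypothesis.
    have hsum := hasSum_integral_of_dominated_convergence (μ := volume)
      (F := fun (m : ℕ) x => (-(2 * Real.pi * Complex.I)) ^ m / m.factorial *
        (((inner ℝ ξ x : ℝ) : ℂ) ^ m * G x))
      (f := fun x => Complex.exp (-(2 * Real.pi * Complex.I) * (inner ℝ ξ x : ℝ)) * G x)
      (fun m x => (2 * Real.pi * |(inner ℝ ξ x : ℝ)|) ^ m / m.factorial * ‖G x‖)
      (fun m => by
        refine AEStronglyMeasurable.const_mul (AEStronglyMeasurable.mul
          (Continuous.aestronglyMeasurable (by fun_prop)) hGint.1) _)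
      (fun m => Filter.Eventually.of_forall fun x => by
        apply le_of_eq
        simp only [norm_mul, norm_div, norm_pow, norm_neg, Complex.norm_I, Complex.norm_real,
          Complex.norm_natCast, Real.norm_eq_abs, abs_of_pos Real.pi_pos, Complex.norm_ofNat,
          mul_one, mul_pow]
        ring)
      (Filter.Eventually.of_forall fun x =>
        (Real.summable_pow_div_factorial _).mul_right _)
      (by
        refine hdom.congr (Filter.Eventually.of_forall fun x => ?_)
        simp only
        rw [tsum_mul_right, Real.exp_eq_exp_ℝ, NormedSpace.exp_eq_tsum_div])
      (Filter.Eventually.of_forall fun x => by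
        have := (NormedSpace.expSeries_div_hasSum_exp
          (-(2 * Real.pi * Complex.I) * ((inner ℝ ξ x : ℝ) : ℂ))).mul_right (G x)
        rw [← Complex.exp_eq_exp_ℂ] at this
        have hm : ∀ m : ℕ, (-(2 * Real.pi * Complex.I)) ^ m / m.factorial *
            (((inner ℝ ξ x : ℝ) : ℂ) ^ m * G x) =
            (-(2 * Real.pi * Complex.I) * ((inner ℝ ξ x : ℝ) : ℂ)) ^ m / m.factorial * G x := by
          intro m
          rw [mul_pow]
          ring
        simpa only [hm] using this)
    have hterm : ∀ m : ℕ, ∫ x, (-(2 * Real.pi * Complex.I)) ^ m / m.factorial *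
        (((inner ℝ ξ x : ℝ) : ℂ) ^ m * G x) = 0 := by
      intro m
      rw [integral_const_mul, ← inner_position_pow_groundState b hw, h, mul_zero]
    simp only [hterm] at hsum
    have h0 := hsum.unique hasSum_zero
    rw [Real.fourier_eq', ← h0]
    refine integral_congr_ae (Filter.Eventually.of_forall fun x => ?_)
    simp only [smul_eq_mul]
    congr 2
    rw [real_inner_comm]
    push_cast
    ring
  rw [Lp.eq_zero_iff_ae_eq_zero]
  filter_upwards [hzero] with x hx
  simp only [hG, Pi.zero_apply, mul_eq_zero, Complex.ofReal_eq_zero] at hx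
  exact hx.resolve_left (Real.exp_pos _).ne'

end Completeness

end HarmonicOscillator

namespace HarmonicOscillator

open scoped LineDeriv ComplexConjugate FourierTransform
open Filter Topology

/-! ### Closedness of the Laplacian and of multiplication -/

section Sobolev

variable {n : ℕ}

/-- Compare Fourier multipliers: the Bessel potential has symbol `1 + ‖ξ‖²`, the Laplacian
`-(2π)²‖ξ‖²`. -/
theorem besselPotential_two_apply (f : 𝓢'(EuclideanSpace ℝ (Fin n), ℂ)) :
    TemperedDistribution.besselPotential (EuclideanSpace ℝ (Fin n)) ℂ 2 f =
      f - ((2 * Real.pi) ^ 2)⁻¹ • Δ f := by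
  have h1 : (fun x : EuclideanSpace ℝ (Fin n) => (((1 + ‖x‖ ^ 2) ^ ((2 : ℝ) / 2) : ℝ) : ℂ)) =
      (fun _ => (1 : ℂ)) + fun x => Complex.ofReal (‖x‖ ^ 2) := by
    ext x
    simp
  have h2 : (fun x : EuclideanSpace ℝ (Fin n) => Complex.ofReal (‖x‖ ^ 2)).HasTemperateGrowth := by
    fun_prop
  rw [TemperedDistribution.laplacian_eq_fourierMultiplierCLM,
    TemperedDistribution.besselPotential, TemperedDistribution.fourierMultiplierCLM_apply,
    TemperedDistribution.fourierMultiplierCLM_apply, h1,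
    TemperedDistribution.smulLeftCLM_add (Function.HasTemperateGrowth.const 1) h2,
    _root_.add_apply, TemperedDistribution.smulLeftCLM_const, one_smul,
    FourierTransform.fourierInv_add, FourierTransform.fourierInv_fourier_eq, smul_smul]
  have : ((2 * Real.pi) ^ 2)⁻¹ * -(2 * Real.pi) ^ 2 = -1 := by
    field_simp
  rw [this, neg_one_smul, sub_neg_eq_add]

/-- An `L²` function whose distributional Laplacian is in `L²` is an `H²` function. -/
theorem mem_sobolevH2_of_laplacian_eq {u f : L2Space n}
    (h : Δ (u : 𝓢'(EuclideanSpace ℝ (Fin n), ℂ)) = (f : 𝓢'(EuclideanSpace ℝ (Fin n), ℂ))) :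
    u ∈ sobolevH2 n := by
  refine ⟨u - (((2 * Real.pi) ^ 2)⁻¹ : ℝ) • f, ?_⟩
  rw [besselPotential_two_apply, h]
  simp only [← Lp.toTemperedDistributionCLM_apply, map_sub,
    ContinuousLinearMap.map_smul_of_tower]

theorem laplacianFun_eq {u f : L2Space n} (hu : u ∈ sobolevH2 n)
    (h : Δ (u : 𝓢'(EuclideanSpace ℝ (Fin n), ℂ)) = (f : 𝓢'(EuclideanSpace ℝ (Fin n), ℂ))) :
    laplacianFun ⟨u, hu⟩ = f :=
  toDistribution_injective ((laplacianFun_spec ⟨u, hu⟩).trans h)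

/-- Closedness of the distributional Laplacian: put `Δ` on the test function and use that `L²`
convergence implies convergence as distributions. -/
theorem laplacian_eq_of_tendsto {ι : Type*} {l : Filter ι} [l.NeBot] {u f : ι → L2Space n}
    {u₀ f₀ : L2Space n} (hu : Tendsto u l (𝓝 u₀)) (hf : Tendsto f l (𝓝 f₀))
    (h : ∀ i, Δ (u i : 𝓢'(EuclideanSpace ℝ (Fin n), ℂ)) =
      (f i : 𝓢'(EuclideanSpace ℝ (Fin n), ℂ))) :
    Δ (u₀ : 𝓢'(EuclideanSpace ℝ (Fin n), ℂ)) = (f₀ : 𝓢'(EuclideanSpace ℝ (Fin n), ℂ)) := by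
  have hc := (Lp.toTemperedDistributionCLM ℂ
    (volume : Measure (EuclideanSpace ℝ (Fin n))) 2).continuous
  ext φ
  have h1 : ∀ ψ : 𝓢(EuclideanSpace ℝ (Fin n), ℂ), ∀ {v : ι → L2Space n} {v₀ : L2Space n},
      Tendsto v l (𝓝 v₀) → Tendsto (fun i => (v i : 𝓢'(EuclideanSpace ℝ (Fin n), ℂ)) ψ) l
        (𝓝 ((v₀ : 𝓢'(EuclideanSpace ℝ (Fin n), ℂ)) ψ)) := by
    intro ψ v v₀ hv
    have h2 := (hc.tendsto v₀).comp hv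
    exact ((PointwiseConvergenceCLM.evalCLM (RingHom.id ℂ) ℂ ψ).continuous.tendsto _).comp h2
  rw [TemperedDistribution.laplacian_apply_apply]
  refine tendsto_nhds_unique (h1 (Δ φ) hu) ((h1 φ hf).congr fun i => ?_)
  rw [← h i, TemperedDistribution.laplacian_apply_apply]

/-- Multiplication by a real function is a closed operator. -/
theorem potential_of_tendsto {V : EuclideanSpace ℝ (Fin n) → ℝ} {u f : ℕ → L2Space n}
    {u₀ f₀ : L2Space n} (hu : Tendsto u atTop (𝓝 u₀)) (hf : Tendsto f atTop (𝓝 f₀))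
    (h : ∀ i, ∀ᵐ x, f i x = (V x : ℂ) * u i x) :
    ∀ᵐ x, f₀ x = (V x : ℂ) * u₀ x := by
  -- Pass to an almost everywhere convergent subsequence for `u`, then to a further one for `f`, so
  -- that both limits hold at the same points.
  obtain ⟨s, hs, hsu⟩ := (tendstoInMeasure_of_tendsto_Lp hu).exists_seq_tendsto_ae
  obtain ⟨t, ht, htf⟩ :=
    (tendstoInMeasure_of_tendsto_Lp (hf.comp hs.tendsto_atTop)).exists_seq_tendsto_ae
  filter_upwards [hsu, htf, ae_all_iff.mpr h] with x hx1 hx2 hx3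
  refine tendsto_nhds_unique hx2 ?_
  refine ((hx1.comp ht.tendsto_atTop).const_mul (V x : ℂ)).congr fun i => ?_
  simp only [Function.comp_apply, hx3]

theorem mem_potentialDomain_of_ae_eq {V : EuclideanSpace ℝ (Fin n) → ℝ} {u f : L2Space n}
    (h : ∀ᵐ x, f x = (V x : ℂ) * u x) : u ∈ potentialDomain V :=
  (Lp.memLp f).ae_eq h

theorem potentialFun_eq {V : EuclideanSpace ℝ (Fin n) → ℝ} {u f : L2Space n}
    (hu : u ∈ potentialDomain V) (h : ∀ᵐ x, f x = (V x : ℂ) * u x) :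
    potentialFun V ⟨u, hu⟩ = f := by
  apply Lp.ext
  filter_upwards [h, potentialFun_ae_eq V ⟨u, hu⟩] with x h1 h2
  rw [h1, h2]

theorem harmonicOscillator_eq {A : Matrix (Fin n) (Fin n) ℝ} {u f g : L2Space n}
    (hf : Δ (u : 𝓢'(EuclideanSpace ℝ (Fin n), ℂ)) = (f : 𝓢'(EuclideanSpace ℝ (Fin n), ℂ)))
    (hg : ∀ᵐ x, g x = (quadraticPotential A x : ℂ) * u x) :
    ∃ h : u ∈ (harmonicOscillator A).domain, harmonicOscillator A ⟨u, h⟩ = -f + g := by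
  have h1 := mem_sobolevH2_of_laplacian_eq hf
  have h2 := mem_potentialDomain_of_ae_eq hg
  refine ⟨⟨h1, h2⟩, ?_⟩
  rw [harmonicOscillator_apply A u ⟨h1, h2⟩ h1 h2, laplacianFun_eq h1 hf, potentialFun_eq h2 hg]

end Sobolev

/-! ### The unbounded operator compared with its action on Schwartz functions -/

section OnSchwartz

variable {n : ℕ} (b : OrthonormalBasis (Fin n) ℝ (EuclideanSpace ℝ (Fin n))) {w : Fin n → ℝ}
  {A : Matrix (Fin n) (Fin n) ℝ}

theorem schwartzLaplacian_apply (φ : 𝓢(EuclideanSpace ℝ (Fin n), ℂ)) :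
    schwartzLaplacian b φ = Δ φ := by
  rw [SchwartzMap.laplacian_eq_sum b]
  simp only [schwartzLaplacian, LinearMap.sum_apply, LinearMap.comp_apply, partialDeriv_apply]

theorem laplacian_schwartzToL2 (φ : 𝓢(EuclideanSpace ℝ (Fin n), ℂ)) :
    Δ (schwartzToL2 n φ : 𝓢'(EuclideanSpace ℝ (Fin n), ℂ)) =
      (schwartzToL2 n (schwartzLaplacian b φ) : 𝓢'(EuclideanSpace ℝ (Fin n), ℂ)) := by
  rw [schwartzToL2_apply, schwartzToL2_apply, Lp.toTemperedDistribution_toLp_eq,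
    Lp.toTemperedDistribution_toLp_eq, TemperedDistribution.laplacian_toTemperedDistributionCLM_eq,
    schwartzLaplacian_apply]

variable {b}

theorem schwartzPotential_apply
    (hV : ∀ x, quadraticPotential A x = ∑ i, w i ^ 2 * (inner ℝ (b i) x : ℝ) ^ 2)
    (φ : 𝓢(EuclideanSpace ℝ (Fin n), ℂ)) (x : EuclideanSpace ℝ (Fin n)) :
    schwartzPotential b w φ x = (quadraticPotential A x : ℂ) * φ x := by
  have h : schwartzPotential b w φ x =
      ∑ i, (w i : ℂ) ^ 2 * (position (b i) (position (b i) φ) x) := by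
    simp [schwartzPotential]
  rw [h, hV]
  push_cast
  rw [Finset.sum_mul]
  refine Finset.sum_congr rfl fun i _ => ?_
  rw [position_apply, position_apply]
  ring

theorem schwartzToL2_schwartzPotential_ae_eq
    (hV : ∀ x, quadraticPotential A x = ∑ i, w i ^ 2 * (inner ℝ (b i) x : ℝ) ^ 2)
    (φ : 𝓢(EuclideanSpace ℝ (Fin n), ℂ)) :
    ∀ᵐ x, schwartzToL2 n (schwartzPotential b w φ) x =
      (quadraticPotential A x : ℂ) * schwartzToL2 n φ x := by
  filter_upwards [coeFn_schwartzToL2 φ, coeFn_schwartzToL2 (schwartzPotential b w φ)] with x h1 h2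
  rw [h1, h2, schwartzPotential_apply hV]

theorem harmonicOscillator_schwartzToL2
    (hV : ∀ x, quadraticPotential A x = ∑ i, w i ^ 2 * (inner ℝ (b i) x : ℝ) ^ 2)
    (φ : 𝓢(EuclideanSpace ℝ (Fin n), ℂ)) :
    ∃ h : schwartzToL2 n φ ∈ (harmonicOscillator A).domain,
      harmonicOscillator A ⟨schwartzToL2 n φ, h⟩ = schwartzToL2 n (schwartzOscillator b w φ) := by
  rw [schwartzOscillator_apply, map_add, map_neg]
  exact harmonicOscillator_eq (laplacian_schwartzToL2 b φ)
    (schwartzToL2_schwartzPotential_ae_eq hV φ)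

/-- The harmonic oscillator is an extension of the closure of its restriction to Schwartz
functions. -/
theorem harmonicOscillator_of_tendsto
    (hV : ∀ x, quadraticPotential A x = ∑ i, w i ^ 2 * (inner ℝ (b i) x : ℝ) ^ 2)
    {φ : ℕ → 𝓢(EuclideanSpace ℝ (Fin n), ℂ)} {u f : L2Space n}
    (hu : Tendsto (fun i => schwartzToL2 n (φ i)) atTop (𝓝 u))
    (hf : Tendsto (fun i => schwartzToL2 n (schwartzOscillator b w (φ i))) atTop (𝓝 f)) :
    ∃ h : u ∈ (harmonicOscillator A).domain, harmonicOscillator A ⟨u, h⟩ = f := by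
  have hcauchy : CauchySeq (fun i => schwartzToL2 n (schwartzPotential b w (φ i))) := by
    rw [cauchySeq_iff_tendsto_dist_atTop_0]
    have h1 := cauchySeq_iff_tendsto_dist_atTop_0.mp hu.cauchySeq
    have h2 := cauchySeq_iff_tendsto_dist_atTop_0.mp hf.cauchySeq
    -- The square root of the a priori bound for the differences of the `φ i`, which tends to zero.
    have h3 := (((h2.pow 2).add ((h1.pow 2).const_mul (2 * n * ∑ i, w i ^ 2)))).sqrt
    simp only [ne_eq, OfNat.ofNat_ne_zero, not_false_eq_true, zero_pow, mul_zero, add_zero,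
      Real.sqrt_zero] at h3
    refine squeeze_zero (fun _ => dist_nonneg) (fun p => ?_) h3
    apply Real.le_sqrt_of_sq_le
    simp only [dist_eq_norm, ← map_sub]
    exact norm_schwartzPotential_sq_le b w _
  obtain ⟨g, hg⟩ := cauchySeq_tendsto_of_complete hcauchy
  have hlap : Tendsto (fun i => schwartzToL2 n (schwartzLaplacian b (φ i))) atTop (𝓝 (g - f)) := by
    refine (hg.sub hf).congr fun i => ?_
    rw [schwartzOscillator_apply, map_add, map_neg]
    abel
  have h := harmonicOscillator_eq
    (laplacian_eq_of_tendsto hu hlap fun i => laplacian_schwartzToL2 b (φ i))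
    (potential_of_tendsto hu hg fun i => schwartzToL2_schwartzPotential_ae_eq hV (φ i))
  rwa [neg_sub, sub_add_cancel] at h

theorem inner_schwartzToL2_left (φ : 𝓢(EuclideanSpace ℝ (Fin n), ℂ)) (u : L2Space n) :
    inner ℂ (schwartzToL2 n φ) u =
      (u : 𝓢'(EuclideanSpace ℝ (Fin n), ℂ)) (schwartzConj φ) := by
  rw [Lp.toTemperedDistribution_apply, L2.inner_def]
  refine integral_congr_ae ?_
  filter_upwards [coeFn_schwartzToL2 φ] with x hx
  rw [hx, RCLike.inner_apply, schwartzConj_apply, smul_eq_mul, mul_comm]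

theorem laplacian_schwartzConj (φ : 𝓢(EuclideanSpace ℝ (Fin n), ℂ)) :
    Δ (schwartzConj φ) = schwartzConj (Δ φ) := by
  rw [SchwartzMap.laplacian_eq_sum (EuclideanSpace.basisFun (Fin n) ℝ),
    SchwartzMap.laplacian_eq_sum (EuclideanSpace.basisFun (Fin n) ℝ)]
  simp only [lineDerivOp_schwartzConj]
  exact (map_sum (SchwartzMap.postcompCLM (𝕜 := ℝ) (Complex.conjCLE : ℂ →L[ℝ] ℂ)) _ _).symm

theorem inner_laplacianFun (φ : 𝓢(EuclideanSpace ℝ (Fin n), ℂ)) (u : sobolevH2 n) :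
    inner ℂ (schwartzToL2 n φ) (laplacianFun u) =
      inner ℂ (schwartzToL2 n (schwartzLaplacian b φ)) (u : L2Space n) := by
  rw [inner_schwartzToL2_left, laplacianFun_spec, TemperedDistribution.laplacian_apply_apply,
    laplacian_schwartzConj, inner_schwartzToL2_left, schwartzLaplacian_apply]

/-- Symmetry with one Schwartz argument: `Δ` moves over by definition of the distributional
derivative, and `V` because it is real. This suffices to test eigenvectors against the known
eigenfunctions. -/
theorem inner_harmonicOscillator
    (hV : ∀ x, quadraticPotential A x = ∑ i, w i ^ 2 * (inner ℝ (b i) x : ℝ) ^ 2)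
    (φ : 𝓢(EuclideanSpace ℝ (Fin n), ℂ)) (u : (harmonicOscillator A).domain) :
    inner ℂ (schwartzToL2 n φ) (harmonicOscillator A u) =
      inner ℂ (schwartzToL2 n (schwartzOscillator b w φ)) (u : L2Space n) := by
  obtain ⟨u, hu⟩ := u
  have hpot : inner ℂ (schwartzToL2 n φ) (potentialFun (quadraticPotential A) ⟨u, hu.2⟩) =
      inner ℂ (schwartzToL2 n (schwartzPotential b w φ)) u := by
    rw [L2.inner_def, L2.inner_def]
    refine integral_congr_ae ?_
    filter_upwards [potentialFun_ae_eq (quadraticPotential A) ⟨u, hu.2⟩,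
      schwartzToL2_schwartzPotential_ae_eq hV φ] with x h1 h2
    rw [h1, h2]
    simp only [RCLike.inner_apply, map_mul, Complex.conj_ofReal]
    ring
  rw [harmonicOscillator_apply A u hu hu.1 hu.2, schwartzOscillator_apply, map_add, map_neg,
    inner_add_right, inner_add_left, inner_neg_right, inner_neg_left, hpot, inner_laplacianFun]

end OnSchwartz

end HarmonicOscillator

/-! ### Resolvent criterion for unbounded operators -/

section Resolvent

variable {H : Type*} [NormedAddCommGroup H] [NormedSpace ℂ H]

theorem unboundedEigenvalues_subset_unboundedSpectrum (T : H →ₗ.[ℂ] H) :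
    unboundedEigenvalues T ⊆ unboundedSpectrum T := by
  rintro z ⟨u, hu, hTu⟩ ⟨R, -, hR⟩
  have := hR u
  rw [hTu, sub_self, map_zero] at this
  exact hu this.symm

/-- A point that is not an eigenvalue and where `T - z` has solutions with a norm bound is in the
resolvent set. -/
theorem mem_unboundedResolventSet_of_exists {T : H →ₗ.[ℂ] H} {z : ℂ} (C : ℝ)
    (hinj : z ∉ unboundedEigenvalues T)
    (hsurj : ∀ f : H, ∃ u : T.domain, T u - z • (u : H) = f ∧ ‖(u : H)‖ ≤ C * ‖f‖) :
    z ∈ unboundedResolventSet T := by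
  have huniq : ∀ u v : T.domain, T u - z • (u : H) = T v - z • (v : H) → u = v := by
    intro u v huv
    by_contra hne
    refine hinj ⟨u - v, ?_, ?_⟩
    · rw [Submodule.coe_sub, sub_ne_zero]
      exact fun h => hne (Subtype.ext h)
    · rw [LinearPMap.map_sub, Submodule.coe_sub, smul_sub, sub_eq_sub_iff_sub_eq_sub]
      exact huv
  choose r hr hrC using hsurj
  let R₀ : H →ₗ[ℂ] T.domain :=
    { toFun := r
      map_add' := fun f g => huniq _ _ <| by
        rw [hr, LinearPMap.map_add, Submodule.coe_add, smul_add, add_sub_add_comm, hr, hr]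
      map_smul' := fun c f => huniq _ _ <| by
        rw [hr, RingHom.id_apply, LinearPMap.map_smul, Submodule.coe_smul, smul_comm z c,
          ← smul_sub, hr] }
  refine ⟨(T.domain.subtype ∘ₗ R₀).mkContinuous C hrC, fun f => ⟨(r f).2, hr f⟩, fun u => ?_⟩
  exact congrArg Subtype.val (huniq _ _ (hr (T u - z • (u : H))))

end Resolvent

namespace HarmonicOscillator

open Filter Topology

/-! ### Discreteness of the energies -/

section Energy

variable {n : ℕ} {w : Fin n → ℝ}

theorem finite_energy_le (hw : ∀ i, 0 < w i) (B : ℝ) : {k : Fin n → ℕ | energy w k ≤ B}.Finite := by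
  refine (Set.finite_Iic (fun i : Fin n => ⌊B / w i⌋₊)).subset fun k hk i => ?_
  refine Nat.le_floor ?_
  rw [le_div_iff₀ (hw i)]
  have h1 : (2 * (k i : ℝ) + 1) * w i ≤ energy w k :=
    Finset.single_le_sum (f := fun i => (2 * (k i : ℝ) + 1) * w i)
      (fun j _ => mul_nonneg (by positivity) (hw j).le) (Finset.mem_univ i)
  have h2 : (k i : ℝ) * w i ≤ (2 * (k i : ℝ) + 1) * w i :=
    mul_le_mul_of_nonneg_right (by linarith [(k i).cast_nonneg (α := ℝ)]) (hw i).le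
  exact (h2.trans h1).trans hk

theorem exists_energy_gap (hw : ∀ i, 0 < w i) {z : ℂ} (hz : ∀ k, ((energy w k : ℝ) : ℂ) ≠ z) :
    ∃ δ : ℝ, 0 < δ ∧ ∀ k, δ ≤ ‖((energy w k : ℝ) : ℂ) - z‖ := by
  -- Energies above `‖z‖ + 1` are at distance at least `1` from `z`; only finitely many
  -- multi-indices remain.
  set s := (finite_energy_le hw (‖z‖ + 1)).toFinset with hs
  have hpos : ∀ k, 0 < ‖((energy w k : ℝ) : ℂ) - z‖ := fun k =>
    norm_pos_iff.mpr (sub_ne_zero.mpr (hz k))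
  have hfar : ∀ k, k ∉ s → 1 ≤ ‖((energy w k : ℝ) : ℂ) - z‖ := by
    intro k hk
    rw [hs, Set.Finite.mem_toFinset, Set.mem_ofPred_eq, not_le] at hk
    have h1 := norm_sub_norm_le ((energy w k : ℝ) : ℂ) z
    rw [Complex.norm_real] at h1
    linarith [Real.le_norm_self (energy w k)]
  rcases s.eq_empty_or_nonempty with he | hne
  · exact ⟨1, one_pos, fun k => hfar k (by simp [he])⟩
  · obtain ⟨k₀, -, hk₀⟩ := s.exists_min_image (fun k => ‖((energy w k : ℝ) : ℂ) - z‖) hne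
    refine ⟨min 1 ‖((energy w k₀ : ℝ) : ℂ) - z‖, lt_min one_pos (hpos k₀), fun k => ?_⟩
    by_cases hk : k ∈ s
    · exact (min_le_right _ _).trans (hk₀ k hk)
    · exact (min_le_left _ _).trans (hfar k hk)

end Energy

/-! ### Orthogonality, density and inversion on the sum of eigenspaces -/

section EigenspaceSum

variable {n : ℕ} (b : OrthonormalBasis (Fin n) ℝ (EuclideanSpace ℝ (Fin n))) (w : Fin n → ℝ)

/-- The algebraic sum of the eigenspaces of the oscillator on Schwartz functions that belong to the
energies `∑ᵢ (2 kᵢ + 1) wᵢ`. -/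
noncomputable def eigenspaceSum : Submodule ℂ 𝓢(EuclideanSpace ℝ (Fin n), ℂ) :=
  ⨆ μ : Set.range (energy w), Module.End.eigenspace (schwartzOscillator b w) ((μ : ℝ) : ℂ)

variable {b w}

theorem mem_eigenspaceSum {φ : 𝓢(EuclideanSpace ℝ (Fin n), ℂ)} {k : Fin n → ℕ}
    (h : schwartzOscillator b w φ = ((energy w k : ℝ) : ℂ) • φ) : φ ∈ eigenspaceSum b w :=
  Submodule.mem_iSup_of_mem (⟨energy w k, k, rfl⟩ : Set.range (energy w))
    (Module.End.mem_eigenspace_iff.mpr h)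

theorem inner_eq_zero_of_schwartzOscillator {φ ψ : 𝓢(EuclideanSpace ℝ (Fin n), ℂ)} {μ ν : ℝ}
    (hμν : μ ≠ ν) (hφ : schwartzOscillator b w φ = (μ : ℂ) • φ)
    (hψ : schwartzOscillator b w ψ = (ν : ℂ) • ψ) :
    inner ℂ (schwartzToL2 n φ) (schwartzToL2 n ψ) = 0 := by
  have h := inner_schwartzOscillator_left b w φ ψ
  rw [hφ, hψ, map_smul, map_smul, inner_smul_left, inner_smul_right, Complex.conj_ofReal,
    ← sub_eq_zero, ← sub_mul] at h
  exact (mul_eq_zero.mp h).resolve_left (sub_ne_zero.mpr (Complex.ofReal_injective.ne hμν))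

/-- The index is the energy value, not the multi-index, so coinciding energies share one eigenspace
and symmetry alone gives orthogonality. -/
theorem orthogonalFamily_eigenspace :
    OrthogonalFamily ℂ (fun μ : Set.range (energy w) => (Submodule.map (schwartzToL2 n)
      (Module.End.eigenspace (schwartzOscillator b w) ((μ : ℝ) : ℂ))))
      (fun μ => (Submodule.map (schwartzToL2 n)
        (Module.End.eigenspace (schwartzOscillator b w) ((μ : ℝ) : ℂ))).subtypeₗᵢ) := by
  rintro μ ν hμν ⟨_, φ, hφ, rfl⟩ ⟨_, ψ, hψ, rfl⟩
  exact inner_eq_zero_of_schwartzOscillator (fun h => hμν (Subtype.ext h))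
    (Module.End.mem_eigenspace_iff.mp hφ) (Module.End.mem_eigenspace_iff.mp hψ)

/-- Pythagoras: on the component of energy `μ` the operator acts as the scalar `μ - z`, of modulus
at least `δ`. -/
theorem le_norm_schwartzOscillator_sub {z : ℂ} {δ : ℝ} (hδ0 : 0 ≤ δ)
    (hδ : ∀ k, δ ≤ ‖((energy w k : ℝ) : ℂ) - z‖) {φ : 𝓢(EuclideanSpace ℝ (Fin n), ℂ)}
    (hφ : φ ∈ eigenspaceSum b w) :
    δ * ‖schwartzToL2 n φ‖ ≤ ‖schwartzToL2 n (schwartzOscillator b w φ - z • φ)‖ := by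
  obtain ⟨f, hf, rfl⟩ := (Submodule.mem_iSup_iff_exists_finsupp _ _).mp hφ
  have horth : ∀ c : Set.range (energy w) → ℂ,
      ‖schwartzToL2 n (∑ μ ∈ f.support, c μ • f μ)‖ ^ 2 =
        ∑ μ ∈ f.support, ‖c μ‖ ^ 2 * ‖schwartzToL2 n (f μ)‖ ^ 2 := by
    intro c
    have h := (orthogonalFamily_eigenspace (b := b) (w := w)).norm_sum
      (fun μ => ⟨schwartzToL2 n (c μ • f μ),
        Submodule.mem_map_of_mem (Submodule.smul_mem _ _ (hf μ))⟩) f.support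
    change ‖∑ μ ∈ f.support, schwartzToL2 n (c μ • f μ)‖ ^ 2 =
      ∑ μ ∈ f.support, ‖schwartzToL2 n (c μ • f μ)‖ ^ 2 at h
    rw [map_sum, h]
    refine Finset.sum_congr rfl fun μ _ => ?_
    rw [map_smul, norm_smul, mul_pow]
  have h1 : schwartzOscillator b w (f.sum fun _ ψ => ψ) - z • (f.sum fun _ ψ => ψ) =
      ∑ μ ∈ f.support, (((μ : ℝ) : ℂ) - z) • f μ := by
    simp only [Finsupp.sum, map_sum, Finset.smul_sum, ← Finset.sum_sub_distrib]
    refine Finset.sum_congr rfl fun μ _ => ?_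
    rw [Module.End.mem_eigenspace_iff.mp (hf μ), sub_smul]
  have h2 : (f.sum fun _ ψ => ψ) = ∑ μ ∈ f.support, (1 : ℂ) • f μ := by
    simp [Finsupp.sum]
  rw [h1, h2]
  refine le_of_sq_le_sq ?_ (norm_nonneg _)
  rw [mul_pow, horth, horth, Finset.mul_sum]
  refine Finset.sum_le_sum fun μ _ => ?_
  obtain ⟨_, k, rfl⟩ := μ
  rw [norm_one, one_pow, one_mul]
  gcongr
  exact hδ k

theorem exists_schwartzOscillator_sub_eq {z : ℂ} (hz : ∀ k, ((energy w k : ℝ) : ℂ) ≠ z)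
    {f : 𝓢(EuclideanSpace ℝ (Fin n), ℂ)} (hf : f ∈ eigenspaceSum b w) :
    ∃ φ ∈ eigenspaceSum b w, schwartzOscillator b w φ - z • φ = f := by
  induction hf using Submodule.iSup_induction' with
  | mem μ x hx =>
    obtain ⟨_, k, rfl⟩ := μ
    have hx' := Module.End.mem_eigenspace_iff.mp hx
    refine ⟨(((energy w k : ℝ) : ℂ) - z)⁻¹ • x, Submodule.smul_mem _ _ (mem_eigenspaceSum hx'), ?_⟩
    rw [map_smul, hx', smul_comm z, ← smul_sub, ← sub_smul,
      inv_smul_smul₀ (sub_ne_zero.mpr (hz k))]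
  | zero => exact ⟨0, Submodule.zero_mem _, by simp⟩
  | add x y _ _ hx hy =>
    obtain ⟨φ, hφ, rfl⟩ := hx
    obtain ⟨ψ, hψ, rfl⟩ := hy
    refine ⟨φ + ψ, Submodule.add_mem _ hφ hψ, ?_⟩
    rw [map_add, smul_add, add_sub_add_comm]

theorem position_pow_groundState_mem (hw : ∀ i, 0 < w i) (v : EuclideanSpace ℝ (Fin n)) (m : ℕ) :
    (position v)^[m] (groundState b hw) ∈ eigenspaceSum b w := by
  have hle : Submodule.span ℂ {ψ | ∃ l, IsExcited b w (groundState b hw) l ψ} ≤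
      eigenspaceSum b w := by
    refine Submodule.span_le.mpr ?_
    rintro ψ ⟨l, hl⟩
    exact mem_eigenspaceSum (hl.schwartzOscillator_eq (lowering_groundState b hw))
  refine hle ?_
  induction m with
  | zero => exact Submodule.subset_span ⟨0, .ground⟩
  | succ m ih =>
    rw [Function.iterate_succ_apply']
    exact position_mem_span_isExcited (lowering_groundState b hw) hw v ih

theorem eq_zero_of_inner_eigenspaceSum (hw : ∀ i, 0 < w i) {u : L2Space n}
    (h : ∀ φ ∈ eigenspaceSum b w, inner ℂ (schwartzToL2 n φ) u = 0) : u = 0 :=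
  eq_zero_of_inner_position_pow_groundState b hw u fun v m =>
    h _ (position_pow_groundState_mem hw v m)

theorem exists_tendsto_eigenspaceSum (b : OrthonormalBasis (Fin n) ℝ (EuclideanSpace ℝ (Fin n)))
    (hw : ∀ i, 0 < w i) (f : L2Space n) :
    ∃ φ : ℕ → 𝓢(EuclideanSpace ℝ (Fin n), ℂ), (∀ i, φ i ∈ eigenspaceSum b w) ∧
      Tendsto (fun i => schwartzToL2 n (φ i)) atTop (𝓝 f) := by
  have htop : ((eigenspaceSum b w).map (schwartzToL2 n)).topologicalClosure = ⊤ := by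
    rw [Submodule.topologicalClosure_eq_top_iff, Submodule.eq_bot_iff]
    intro u hu
    refine eq_zero_of_inner_eigenspaceSum (b := b) hw fun φ hφ => ?_
    exact (Submodule.mem_orthogonal _ _).mp hu _ (Submodule.mem_map_of_mem hφ)
  have hf : f ∈ closure (((eigenspaceSum b w).map (schwartzToL2 n) : Submodule ℂ (L2Space n)) :
      Set (L2Space n)) := by
    rw [← Submodule.topologicalClosure_coe, htop]
    trivial
  obtain ⟨x, hx, hxf⟩ := mem_closure_iff_seq_limit.mp hf
  choose φ hφ hφx using hx
  exact ⟨φ, hφ, by simpa only [hφx] using hxf⟩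

end EigenspaceSum

/-! ### Eigenvalues and resolvent of the oscillator -/

section Spectrum

variable {n : ℕ} {b : OrthonormalBasis (Fin n) ℝ (EuclideanSpace ℝ (Fin n))} {w : Fin n → ℝ}
  {A : Matrix (Fin n) (Fin n) ℝ}

theorem energy_mem_unboundedEigenvalues (hw : ∀ i, 0 < w i)
    (hV : ∀ x, quadraticPotential A x = ∑ i, w i ^ 2 * (inner ℝ (b i) x : ℝ) ^ 2)
    (k : Fin n → ℕ) : ((energy w k : ℝ) : ℂ) ∈ unboundedEigenvalues (harmonicOscillator A) := by
  obtain ⟨φ, hφ, hφ0⟩ := exists_isExcited_ne_zero (b := b) hw (groundState_ne_zero b hw) k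
  obtain ⟨h, hK⟩ := harmonicOscillator_schwartzToL2 hV φ
  refine ⟨⟨_, h⟩, (map_ne_zero_iff _ schwartzToL2_injective).mpr hφ0, ?_⟩
  rw [hK, hφ.schwartzOscillator_eq (lowering_groundState b hw), map_smul]

/-- For an eigenfunction `x` of energy `E`, symmetry gives `(z - E)⟨x, u⟩ = 0`. If `z` were no
energy, `u` would be orthogonal to a complete system. -/
theorem eq_energy_of_mem_unboundedEigenvalues (hw : ∀ i, 0 < w i)
    (hV : ∀ x, quadraticPotential A x = ∑ i, w i ^ 2 * (inner ℝ (b i) x : ℝ) ^ 2) {z : ℂ}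
    (hz : z ∈ unboundedEigenvalues (harmonicOscillator A)) :
    ∃ k, ((energy w k : ℝ) : ℂ) = z := by
  obtain ⟨u, hu, hKu⟩ := hz
  by_contra! hne
  refine hu (eq_zero_of_inner_eigenspaceSum (b := b) hw fun φ hφ => ?_)
  induction hφ using Submodule.iSup_induction' with
  | mem μ x hx =>
    obtain ⟨_, k, rfl⟩ := μ
    have h := inner_harmonicOscillator hV x u
    rw [hKu, Module.End.mem_eigenspace_iff.mp hx, map_smul, inner_smul_left, inner_smul_right,
      Complex.conj_ofReal, ← sub_eq_zero, ← sub_mul] at h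
    exact (mul_eq_zero.mp h).resolve_left (sub_ne_zero.mpr (hne k).symm)
  | zero => rw [map_zero, inner_zero_left]
  | add x y _ _ hx hy => rw [map_add, inner_add_left, hx, hy, add_zero]

/-- Approximate `f` by finite sums of eigenfunctions and solve exactly for each. The `δ⁻¹` bound
makes the solutions Cauchy, closedness puts their limit in the domain, and the bound survives the
limit. -/
theorem mem_unboundedResolventSet_harmonicOscillator (hw : ∀ i, 0 < w i)
    (hV : ∀ x, quadraticPotential A x = ∑ i, w i ^ 2 * (inner ℝ (b i) x : ℝ) ^ 2) {z : ℂ}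
    (hz : ∀ k, ((energy w k : ℝ) : ℂ) ≠ z) :
    z ∈ unboundedResolventSet (harmonicOscillator A) := by
  obtain ⟨δ, hδ0, hδ⟩ := exists_energy_gap hw hz
  refine mem_unboundedResolventSet_of_exists δ⁻¹ (fun h => ?_) fun f => ?_
  · obtain ⟨k, hk⟩ := eq_energy_of_mem_unboundedEigenvalues hw hV h
    exact hz k hk
  obtain ⟨ψ, hψ, hψf⟩ := exists_tendsto_eigenspaceSum b hw f
  choose φ hφ hφψ using fun i => exists_schwartzOscillator_sub_eq hz (hψ i)
  have hbound : ∀ χ ∈ eigenspaceSum b w, ‖schwartzToL2 n χ‖ ≤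
      δ⁻¹ * ‖schwartzToL2 n (schwartzOscillator b w χ - z • χ)‖ := by
    intro χ hχ
    rw [le_inv_mul_iff₀ hδ0]
    exact le_norm_schwartzOscillator_sub hδ0.le hδ hχ
  have hcauchy : CauchySeq (fun i => schwartzToL2 n (φ i)) := by
    rw [cauchySeq_iff_tendsto_dist_atTop_0]
    have h1 := (cauchySeq_iff_tendsto_dist_atTop_0.mp hψf.cauchySeq).const_mul δ⁻¹
    rw [mul_zero] at h1
    refine squeeze_zero (fun _ => dist_nonneg) (fun p => ?_) h1
    rw [dist_eq_norm, dist_eq_norm, ← map_sub, ← map_sub]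
    have h2 : ψ p.1 - ψ p.2 =
        schwartzOscillator b w (φ p.1 - φ p.2) - z • (φ p.1 - φ p.2) := by
      rw [← hφψ p.1, ← hφψ p.2, map_sub, smul_sub]
      abel
    rw [h2]
    exact hbound _ (Submodule.sub_mem _ (hφ p.1) (hφ p.2))
  obtain ⟨u, hu⟩ := cauchySeq_tendsto_of_complete hcauchy
  have hosc : Tendsto (fun i => schwartzToL2 n (schwartzOscillator b w (φ i))) atTop
      (𝓝 (f + z • u)) := by
    refine (hψf.add (hu.const_smul z)).congr fun i => ?_
    rw [← map_smul, ← map_add, ← hφψ i, sub_add_cancel]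
  obtain ⟨h, hK⟩ := harmonicOscillator_of_tendsto hV hu hosc
  refine ⟨⟨u, h⟩, by rw [hK, add_sub_cancel_right], ?_⟩
  refine le_of_tendsto_of_tendsto hu.norm (hψf.norm.const_mul δ⁻¹) (Eventually.of_forall fun i => ?_)
  have := hbound _ (hφ i)
  rwa [hφψ i] at this

end Spectrum

/-! ### Diagonalisation of the quadratic form -/

section Diagonalization

/-- Equal multiplicities mean equally large fibres; glue bijections between the fibres over each
value. -/
theorem exists_perm_of_map_univ_eq {ι α : Type*} [Fintype ι] {f g : ι → α}
    (h : Finset.univ.val.map f = Finset.univ.val.map g) : ∃ σ : Equiv.Perm ι, g ∘ σ = f := by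
  classical
  have hcard : ∀ c, Fintype.card {i // f i = c} = Fintype.card {i // g i = c} := by
    intro c
    have h1 := congrArg (Multiset.count c) h
    rw [Multiset.count_map, Multiset.count_map] at h1
    simp only [Fintype.card_subtype, Finset.card_def, Finset.filter_val, eq_comm (b := c)]
    exact h1
  let e : (Σ c, {i // f i = c}) ≃ (Σ c, {i // g i = c}) :=
    Equiv.sigmaCongrRight fun c => Fintype.equivOfCardEq (hcard c)
  refine ⟨(Equiv.sigmaFiberEquiv f).symm.trans (e.trans (Equiv.sigmaFiberEquiv g)), ?_⟩
  ext i
  exact (e ((Equiv.sigmaFiberEquiv f).symm i)).2.2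

theorem exists_orthonormalBasis_quadraticPotential_eq {n : ℕ} {A : Matrix (Fin n) (Fin n) ℝ}
    (hA : A.IsHermitian) {w : Fin n → ℝ}
    (hAw : A.charpoly.roots = Finset.univ.val.map (fun i => w i ^ 2)) :
    ∃ b : OrthonormalBasis (Fin n) ℝ (EuclideanSpace ℝ (Fin n)),
      ∀ x, quadraticPotential A x = ∑ i, w i ^ 2 * (inner ℝ (b i) x : ℝ) ^ 2 := by
  rw [hA.roots_charpoly_eq_eigenvalues] at hAw
  obtain ⟨σ, hσ⟩ := exists_perm_of_map_univ_eq hAw.symm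
  -- The numbers `wᵢ²` match the eigenvalues only up to order, so the eigenbasis is permuted: its
  -- new `i`-th vector is the old one at `σ i`.
  refine ⟨hA.eigenvectorBasis.reindex σ.symm, fun x => ?_⟩
  have hq : quadraticPotential A x = inner ℝ x (WithLp.toLp 2 (A.mulVec x)) := by
    simp only [quadraticPotential, PiLp.inner_apply, Matrix.mulVec, dotProduct, RCLike.inner_apply,
      conj_trivial, Finset.sum_mul]
    exact Finset.sum_congr rfl fun i _ => Finset.sum_congr rfl fun j _ => by ring
  have hAx : ∀ i, inner ℝ (hA.eigenvectorBasis i) (WithLp.toLp 2 (A.mulVec x)) =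
      hA.eigenvalues i * inner ℝ (hA.eigenvectorBasis i) x := by
    intro i
    have h1 := hA.mulVec_eigenvectorBasis i
    have h2 : A.transpose = A := by simpa using hA.eq
    rw [EuclideanSpace.inner_eq_star_dotProduct, EuclideanSpace.inner_eq_star_dotProduct]
    simp only [star_trivial]
    rw [dotProduct_comm, Matrix.dotProduct_mulVec, ← Matrix.mulVec_transpose, h2, h1,
      smul_dotProduct, dotProduct_comm, smul_eq_mul]
  have hw : ∀ i, w i ^ 2 = hA.eigenvalues (σ i) := fun i => (congrFun hσ i).symm
  rw [hq, ← hA.eigenvectorBasis.sum_inner_mul_inner, ← Equiv.sum_comp σ]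
  refine Finset.sum_congr rfl fun i _ => ?_
  rw [hAx, hw, OrthonormalBasis.reindex_apply, Equiv.symm_symm, real_inner_comm]
  ring

end Diagonalization

end HarmonicOscillator

theorem mainTheorem4 (n : ℕ) (A : Matrix (Fin n) (Fin n) ℝ) (hA : A.PosDef)
    (w : Fin n → ℝ) (hw : ∀ i, 0 < w i)
    (hAw : A.charpoly.roots = Finset.univ.val.map (fun i => w i ^ 2)) :
    unboundedSpectrum (HarmonicOscillator.harmonicOscillator A) =
        {z : ℂ | ∃ k : Fin n → ℕ, z = ((∑ i, (2 * (k i : ℝ) + 1) * w i : ℝ) : ℂ)} ∧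
      unboundedEigenvalues (HarmonicOscillator.harmonicOscillator A) =
        {z : ℂ | ∃ k : Fin n → ℕ, z = ((∑ i, (2 * (k i : ℝ) + 1) * w i : ℝ) : ℂ)} := by
  obtain ⟨b, hV⟩ :=
    HarmonicOscillator.exists_orthonormalBasis_quadraticPotential_eq hA.isHermitian hAw
  refine ⟨Set.Subset.antisymm (fun z hz => ?_) ?_, Set.Subset.antisymm (fun z hz => ?_) ?_⟩
  · by_contra hne
    refine hz (HarmonicOscillator.mem_unboundedResolventSet_harmonicOscillator hw hV
      fun k hk => hne ⟨k, hk.symm⟩)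
  · rintro _ ⟨k, rfl⟩
    exact unboundedEigenvalues_subset_unboundedSpectrum _
      (HarmonicOscillator.energy_mem_unboundedEigenvalues hw hV k)
  · obtain ⟨k, hk⟩ := HarmonicOscillator.eq_energy_of_mem_unboundedEigenvalues hw hV hz
    exact ⟨k, hk.symm⟩
  · rintro _ ⟨k, rfl⟩
    exact HarmonicOscillator.energy_mem_unboundedEigenvalues hw hV k
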